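/- Let $n,p,m\ge 1$, and let agents $1,\dots,n$ have differentiable cost functions $f_i:\mathbb{R}^p\to\mathbb{R}$ that are $\mu$-strongly convex with $L$-Lipschitz gradients ($\mu>0$): for all $x,x'$, $\langle\nabla f_i(x)-\nabla f_i(x'),x-x'\rangle\ge\mu\|x-x'\|^2$ and $\|\nabla f_i(x)-\nabla f_i(x')\|\le L\|x-x'\|$. Let $x^*$ be the minimizer of $f=\frac1n\sum_i f_i$. The agents form a connected undirected graph, and $W=[w_{ij}]$ is a nonnegative doubly stochastic $n\times n$ matrix such that, for $i\neq j$, $w_{ij}=w_{ji}>0$ if $i,j$ are adjacent and $w_{ij}=w_{ji}=0$ otherwise, and such that $w_{ii}>0$ for some $i$. Let $\xi_{i,k}\in\mathbb{R}^m$ ($1\le i\le n$, $k\ge 0$) be mutually independent random vectors and $g_i:\mathbb{R}^p\times\mathbb{R}^m\to\mathbb{R}^p$ measurable with $\mathbb{E}[g_i(x,\xi_{i,k})]=\nabla f_i(x)$ and $\mathbb{E}\|g_i(x,\xi_{i,k})-\nabla f_i(x)\|^2\le\sigma^2$ for all $i,k,x$, where $\sigma>0$. Starting from arbitrary deterministic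 $x_{i,0}\in\mathbb{R}^p$ and $y_{i,0}=g_i(x_{i,0},\xi_{i,0})$, with a constant step size $\alpha>0$, iterate $$x_{i,k+1}=\sum_{j}w_{ij}(x_{j,k}-\alpha y_{j,k}),\qquad y_{i,k+1}=\sum_j w_{ij}y_{j,k}+g_i(x_{i,k+1},\xi_{i,k+1})-g_i(x_{i,k},\xi_{i,k}).$$ Let $\overline{x}_k=\frac1n\sum_i x_{i,k}$ and $\|\mathbf{x}_k-\mathbf{1}\overline{x}_k\|^2=\sum_i\|x_{i,k}-\overline{x}_k\|^2$. Let $\rho_w$ be the spectral norm of $W-\frac1n\mathbf{1}\mathbf{1}^{\intercal}$ and $\|W-I\|$ the Frobenius norm. Suppose that for some $\Gamma>1$ $$\alpha\le\min\left\{\frac{1-\rho_w^2}{12\rho_w^2L},\ \frac{(1-\rho_w^2)^2}{2\sqrt{\Gamma}L\max\{6\rho_w\|W-I\|,1-\rho_w^2\}},\ \frac{1-\rho_w^2}{3\rho_w^{2/3}L}\left[\frac{\mu^2}{L^2}\frac{\Gamma-1}{\Gamma(\Gamma+1)}\right]^{1/3}\right\},$$ where the first and third terms are read as $+\infty$ if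 $\rho_w=0$. Let $\beta=\frac{1-\rho_w^2}{2\rho_w^2}-4\alpha L-2\alpha^2L^2$, let $\rho_A$ be the spectral radius of $$A=\begin{bmatrix}1-\alpha\mu&\frac{\alpha L^2}{\mu n}(1+\alpha\mu)&0\\0&\frac12(1+\rho_w^2)&\alpha^2\frac{(1+\rho_w^2)\rho_w^2}{1-\rho_w^2}\\2\alpha nL^3&\left(\frac1\beta+2\right)\|W-I\|^2L^2+3\alpha L^3&\frac12(1+\rho_w^2)\end{bmatrix}$$ (if $\rho_w=0$, the spectrum of $A$ does not depend on the entry containing $\beta$), and set $M_\sigma=[3\alpha^2L^2+2(\alpha L+1)(n+1)]\sigma^2$, $$R_1=\frac{\Gamma+1}{\Gamma}\frac{\alpha\sigma^2}{\mu n}+\left(\frac{\Gamma+1}{\Gamma-1}\right)\frac{4\alpha^2L^2(1+\alpha\mu)(1+\rho_w^2)\rho_w^2}{\mu^2n(1-\rho_w^2)^3}M_\sigma,\qquad R_2=\left(\frac{\Gamma+1}{\Gamma-1}\right)\frac{4\alpha^2(1+\rho_w^2)\rho_w^2(2\alpha^2L^3\sigma^2+\mu M_\sigma)}{\mu(1-\rho_w^2)^3}.$$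 Then $\mathbb{E}\|\overline{x}_k-x^*\|^2$ and $\mathbb{E}\|\mathbf{x}_k-\mathbf{1}\overline{x}_k\|^2$ are finite and bounded in $k$, $\rho_A<1$, and both suprema converge to a neighborhood of $0$ at the linear rate $\mathcal{O}(\rho_A^k)$: there are constants $C_1,C_2$ such that for all $k\ge 0$ $$\sup_{l\ge k}\mathbb{E}\|\overline{x}_l-x^*\|^2\le R_1+C_1\rho_A^k,\qquad\sup_{l\ge k}\mathbb{E}\|\mathbf{x}_{l+1}-\mathbf{1}\overline{x}_{l+1}\|^2\le R_2+C_2\rho_A^k.$$ Furthermore, $$\limsup_{k\to\infty}\mathbb{E}\|\overline{x}_k-x^*\|^2\le R_1,\qquad\limsup_{k\to\infty}\mathbb{E}\|\mathbf{x}_k-\mathbf{1}\overline{x}_k\|^2\le R_2.$$ -/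

import Mathlib

open MeasureTheory ProbabilityTheory Filter

/-- The agents communicate over a connected undirected graph `G` (self-loops of the network are
recorded by the diagonal of `W` only); the coupling matrix `W` is nonnegative and doubly stochastic,
with `w i j = w j i > 0` exactly for neighbours, and some diagonal entry is positive. -/
structure IsNetwork {n : ℕ} (G : SimpleGraph (Fin n)) (W : Matrix (Fin n) (Fin n) ℝ) : Prop where
  connected : G.Connected
  nonneg : ∀ i j, 0 ≤ W i j
  symm : ∀ i j, W i j = W j i
  adj_iff : ∀ i j, i ≠ j → (G.Adj i j ↔ 0 < W i j)
  row_sum : ∀ i, ∑ j, W i j = 1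
  col_sum : ∀ j, ∑ i, W i j = 1
  exists_diag_pos : ∃ i, 0 < W i i

/-- `φ` is differentiable and `μ`-strongly convex with `L`-Lipschitz gradient. -/
structure IsStronglyConvexSmooth {p : ℕ} (φ : EuclideanSpace ℝ (Fin p) → ℝ) (μ L : ℝ) : Prop where
  differentiable : Differentiable ℝ φ
  strong : ∀ x x', μ * ‖x - x'‖ ^ 2 ≤ inner ℝ (gradient φ x - gradient φ x') (x - x')
  lipschitz : ∀ x x', ‖gradient φ x - gradient φ x'‖ ≤ L * ‖x - x'‖

/-- Stochastic oracle: the samples `ξ k i` (iteration `k`, agent `i`) are mutually independent,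
and `g i x (ξ k i)` is an unbiased estimate of `∇ f i x` with variance at most `σ ^ 2`. -/
structure IsGradientOracle {Ω : Type*} [MeasurableSpace Ω] (P : Measure Ω) {n p m : ℕ}
    (f : Fin n → EuclideanSpace ℝ (Fin p) → ℝ)
    (g : Fin n → EuclideanSpace ℝ (Fin p) → EuclideanSpace ℝ (Fin m) → EuclideanSpace ℝ (Fin p))
    (ξ : ℕ → Fin n → Ω → EuclideanSpace ℝ (Fin m)) (σ : ℝ) : Prop where
  measurable_sample : ∀ k i, Measurable (ξ k i)
  measurable_oracle : ∀ i, Measurable (fun z : EuclideanSpace ℝ (Fin p) × EuclideanSpace ℝ (Fin m) =>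
    g i z.1 z.2)
  indep : iIndepFun (fun q : ℕ × Fin n => ξ q.1 q.2) P
  memLp : ∀ k i x, MemLp (fun ω => g i x (ξ k i ω)) 2 P
  unbiased : ∀ k i x, ∫ ω, g i x (ξ k i ω) ∂P = gradient (f i) x
  variance_le : ∀ k i x, ∫ ω, ‖g i x (ξ k i ω) - gradient (f i) x‖ ^ 2 ∂P ≤ σ ^ 2

/-- The iterates `(x_k, y_k)` of the distributed stochastic gradient tracking method, started at
`x0`, along the realization `s` of the samples. -/
noncomputable def dsgt {n p m : ℕ} (W : Matrix (Fin n) (Fin n) ℝ) (α : ℝ)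
    (g : Fin n → EuclideanSpace ℝ (Fin p) → EuclideanSpace ℝ (Fin m) → EuclideanSpace ℝ (Fin p))
    (x0 : Fin n → EuclideanSpace ℝ (Fin p)) (s : ℕ → Fin n → EuclideanSpace ℝ (Fin m)) :
    ℕ → (Fin n → EuclideanSpace ℝ (Fin p)) × (Fin n → EuclideanSpace ℝ (Fin p))
  | 0 => (x0, fun i => g i (x0 i) (s 0 i))
  | k + 1 =>
    let x := (dsgt W α g x0 s k).1
    let y := (dsgt W α g x0 s k).2
    let x' : Fin n → EuclideanSpace ℝ (Fin p) := fun i => ∑ j, W i j • (x j - α • y j)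
    (x', fun i => ∑ j, W i j • y j + g i (x' i) (s (k + 1) i) - g i (x i) (s k i))

/-- The average `(1/n) ∑ i, x i` of the rows of `x`. -/
noncomputable def rowMean {n p : ℕ} (x : Fin n → EuclideanSpace ℝ (Fin p)) :
    EuclideanSpace ℝ (Fin p) :=
  (1 / (n : ℝ)) • ∑ i, x i

/-- The squared Frobenius distance of `x` to the matrix all of whose rows equal the row mean. -/
noncomputable def consensusSq {n p : ℕ} (x : Fin n → EuclideanSpace ℝ (Fin p)) : ℝ :=
  ∑ i, ‖x i - rowMean x‖ ^ 2

open scoped Matrix.Norms.L2Operator in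
/-- The spectral norm of `W - (1/n) 1 1ᵀ`. -/
noncomputable def rhoW {n : ℕ} (W : Matrix (Fin n) (Fin n) ℝ) : ℝ :=
  ‖W - Matrix.of (fun _ _ : Fin n => 1 / (n : ℝ))‖

open scoped Matrix.Norms.Frobenius in
/-- The Frobenius norm of `W - I`. -/
noncomputable def distI {n : ℕ} (W : Matrix (Fin n) (Fin n) ℝ) : ℝ :=
  ‖W - 1‖

/-- The upper bound on the step size: `α` is at most the minimum of three quantities, where the
first and the third one are `+∞` for `ρ = 0` (here `ρ` is `rhoW W` and `w` is `distI W`). -/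
def StepSizeBound (α μ L Γ ρ w : ℝ) : Prop :=
  (ρ ≠ 0 → α ≤ (1 - ρ ^ 2) / (12 * ρ ^ 2 * L)) ∧
  α ≤ (1 - ρ ^ 2) ^ 2 / (2 * Real.sqrt Γ * L * max (6 * ρ * w) (1 - ρ ^ 2)) ∧
  (ρ ≠ 0 → α ≤ (1 - ρ ^ 2) / (3 * ρ ^ (2 / 3 : ℝ) * L) *
    (μ ^ 2 / L ^ 2 * ((Γ - 1) / (Γ * (Γ + 1)))) ^ (1 / 3 : ℝ))

/-- The constant `β`. -/
noncomputable def betaConst (α L ρ : ℝ) : ℝ :=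
  (1 - ρ ^ 2) / (2 * ρ ^ 2) - 4 * α * L - 2 * α ^ 2 * L ^ 2

/-- The matrix `A`. For `ρ = 0` its entry `(2,3)` is zero, so that the entry `(3,2)`, the only one
that contains `β`, has no influence on the spectrum. -/
noncomputable def matA (n : ℕ) (α μ L ρ w : ℝ) : Matrix (Fin 3) (Fin 3) ℝ :=
  !![1 - α * μ, α * L ^ 2 / (μ * n) * (1 + α * μ), 0;
     0, (1 + ρ ^ 2) / 2, α ^ 2 * ((1 + ρ ^ 2) * ρ ^ 2 / (1 - ρ ^ 2));
     2 * α * n * L ^ 3, (1 / betaConst α L ρ + 2) * w ^ 2 * L ^ 2 + 3 * α * L ^ 3, (1 + ρ ^ 2) / 2]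

/-- The spectral radius of a real matrix: the largest modulus of a complex eigenvalue. -/
noncomputable def realMatrixSpectralRadius (A : Matrix (Fin 3) (Fin 3) ℝ) : ℝ :=
  (spectralRadius ℂ (A.map Complex.ofReal)).toReal

/-- The constant `M_σ`. -/
noncomputable def Msigma (n : ℕ) (α L σ : ℝ) : ℝ :=
  (3 * α ^ 2 * L ^ 2 + 2 * (α * L + 1) * (n + 1)) * σ ^ 2

/-- The limiting bound on the expected squared distance of the average iterate to the solution. -/
noncomputable def optimalityBound (n : ℕ) (α μ L σ Γ ρ : ℝ) : ℝ :=
  (Γ + 1) / Γ * (α * σ ^ 2 / (μ * n)) +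
    (Γ + 1) / (Γ - 1) *
      (4 * α ^ 2 * L ^ 2 * (1 + α * μ) * (1 + ρ ^ 2) * ρ ^ 2 / (μ ^ 2 * n * (1 - ρ ^ 2) ^ 3)) *
      Msigma n α L σ

/-- The limiting bound on the expected squared consensus error. -/
noncomputable def consensusBound (n : ℕ) (α μ L σ Γ ρ : ℝ) : ℝ :=
  (Γ + 1) / (Γ - 1) *
    (4 * α ^ 2 * (1 + ρ ^ 2) * ρ ^ 2 * (2 * α ^ 2 * L ^ 3 * σ ^ 2 + μ * Msigma n α L σ) /
      (μ * (1 - ρ ^ 2) ^ 3))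

/-- `E ‖x̄_k - x*‖²`. -/
noncomputable def optimalityError {Ω : Type*} [MeasurableSpace Ω] (P : Measure Ω) {n p : ℕ}
    (X : ℕ → Ω → Fin n → EuclideanSpace ℝ (Fin p)) (xs : EuclideanSpace ℝ (Fin p)) (k : ℕ) : ℝ :=
  ∫ ω, ‖rowMean (X k ω) - xs‖ ^ 2 ∂P

/-- `E ‖x_k - 1 x̄_k‖²`. -/
noncomputable def consensusError {Ω : Type*} [MeasurableSpace Ω] (P : Measure Ω) {n p : ℕ}
    (X : ℕ → Ω → Fin n → EuclideanSpace ℝ (Fin p)) (k : ℕ) : ℝ :=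
  ∫ ω, consensusSq (X k ω) ∂P

/-! Three quantities are followed together: the expected squared distance of the mean iterate to
`xs`, the consensus error of the iterates and the consensus error of the trackers. They obey a
coupled linear inequality with the nonnegative matrix `matA` and the constant forcing `(α²σ²/n, 0,
Msigma)`; see `optimalityError_succ_le`, `consensusError_succ_le` and `trackingError_succ_le`.

Double stochasticity preserves averages, so the mean tracker equals the mean stochastic gradient and
the mean iterate performs an inexact gradient step. Co-coercivity makes that step contract by `1 -
αμ`, up to the disagreement of the agents and averaged noise of variance at most `σ²/n`. Mixing
contracts disagreement by `rhoW W`, and Young's inequality gives away half of the gap `1 - ρ²`. The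
trackers are disturbed by the change of the gradients over one step, which the Lipschitz condition
controls.

The estimates are first proved for each realization, with the noise kept in exact inner products. In
expectation these mostly vanish, because the noise of a sample is orthogonal to whatever is built
from the other samples (`integral_inner_gradNoise_eq_zero`). The tracker contains the current noise,
so some variance terms survive; they make up `Msigma`.

The matrix has two feedback loops, consensus-tracking and the full 3-cycle. The step size conditions
make both loop gains small against the gaps `1 - A i i` (`StepSizeBound.consensus_tracking_le`,
`StepSizeBound.cycle_le`), which bounds `det (1 - A)` below by a positive constant. Hence the
characteristic polynomial has a root `r < 1` that dominates all eigenvalues and carries a positive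
eigenvector `v`; the errors stay below the fixed point of the recursion plus a multiple of `r ^ k •
v`. Cramer's rule and the determinant bound give the two limiting constants. For `ρ = 0` consensus
is exact after one step and a scalar recursion remains. -/

/-! ### Gradient steps for strongly convex smooth functions -/

section Convex

variable {F : Type*} [NormedAddCommGroup F] [InnerProductSpace ℝ F] [CompleteSpace F]

/-- The derivative of `t ↦ φ (x + t • d)`. -/
theorem hasDerivAt_comp_line {φ : F → ℝ} (hφ : Differentiable ℝ φ) (x d : F) (t : ℝ) :
    HasDerivAt (fun t : ℝ => φ (x + t • d)) (inner ℝ (gradient φ (x + t • d)) d) t := by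
  have h1 : HasDerivAt (fun t : ℝ => x + t • d) d t := by
    simpa using ((hasDerivAt_id t).smul_const d).const_add x
  have h2 := (hφ (x + t • d)).hasGradientAt.hasFDerivAt.comp_hasDerivAt t h1
  simpa [Function.comp_def] using h2

/-- A bound on the growth of the gradient along segments bounds the function from above. -/
theorem le_of_inner_gradient_sub_le {φ : F → ℝ} (hφ : Differentiable ℝ φ) {c : ℝ}
    (h : ∀ x x', inner ℝ (gradient φ x - gradient φ x') (x - x') ≤ c * ‖x - x'‖ ^ 2) (x y : F) :
    φ y ≤ φ x + inner ℝ (gradient φ x) (y - x) + c / 2 * ‖y - x‖ ^ 2 := by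
  set d := y - x with hd
  -- The function along the segment minus its quadratic model: it suffices that `ψ` decreases from
  -- `t = 0` to `t = 1`.
  let ψ : ℝ → ℝ := fun t => φ (x + t • d) - t * inner ℝ (gradient φ x) d - c / 2 * t ^ 2 * ‖d‖ ^ 2
  have hψ : ∀ t, HasDerivAt ψ (inner ℝ (gradient φ (x + t • d)) d - inner ℝ (gradient φ x) d
      - c * t * ‖d‖ ^ 2) t := by
    intro t
    have h1 := hasDerivAt_comp_line hφ x d t
    have h2 : HasDerivAt (fun t : ℝ => t * inner ℝ (gradient φ x) d)
      (inner ℝ (gradient φ x) d) t := by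
      simpa using (hasDerivAt_id t).mul_const (inner ℝ (gradient φ x) d)
    have h3 : HasDerivAt (fun t : ℝ => c / 2 * t ^ 2 * ‖d‖ ^ 2) (c * t * ‖d‖ ^ 2) t := by
      have := ((hasDerivAt_pow 2 t).const_mul (c / 2)).mul_const (‖d‖ ^ 2)
      refine this.congr_deriv ?_
      rw [show 2 - 1 = 1 from rfl, pow_one]
      push_cast
      ring
    exact (h1.sub h2).sub h3
  have hanti : AntitoneOn ψ (Set.Icc 0 1) := by
    apply antitoneOn_of_deriv_nonpos (convex_Icc 0 1)
    · exact fun t _ => (hψ t).continuousAt.continuousWithinAt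
    · exact fun t _ => (hψ t).differentiableAt.differentiableWithinAt
    · intro t ht
      rw [interior_Icc] at ht
      rw [(hψ t).deriv]
      have h1 := h (x + t • d) x
      rw [add_sub_cancel_left, inner_smul_right, norm_smul, Real.norm_of_nonneg ht.1.le,
        inner_sub_left, mul_pow] at h1
      -- The hypothesis at `x + t • d` and `x` carries an extra factor `t`, divided out since `t >
      -- 0`.
      have h2 : t * (inner ℝ (gradient φ (x + t • d)) d - inner ℝ (gradient φ x) d
        - c * t * ‖d‖ ^ 2) ≤ 0 := by linarith
      exact nonpos_of_mul_nonpos_right h2 ht.1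
  have h01 := hanti (Set.left_mem_Icc.2 zero_le_one) (Set.right_mem_Icc.2 zero_le_one) zero_le_one
  simp only [ψ, zero_smul, add_zero, one_smul] at h01
  have : x + d = y := by simp [hd]
  rw [this] at h01
  linarith

theorem gradient_fun_neg {φ : F → ℝ} (hφ : Differentiable ℝ φ) (x : F) :
    gradient (fun z => -φ z) x = -gradient φ x := by
  have h := (hφ x).hasGradientAt.hasFDerivAt.neg
  have : HasGradientAt (fun z => -φ z) (-gradient φ x) x := by
    rw [hasGradientAt_iff_hasFDerivAt, map_neg]
    exact h
  exact this.gradient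

/-- A lower bound on the growth of the gradient bounds the function from below. -/
theorem le_of_le_inner_gradient_sub {φ : F → ℝ} (hφ : Differentiable ℝ φ) {c : ℝ}
    (h : ∀ x x', c * ‖x - x'‖ ^ 2 ≤ inner ℝ (gradient φ x - gradient φ x') (x - x')) (x y : F) :
    φ x + inner ℝ (gradient φ x) (y - x) + c / 2 * ‖y - x‖ ^ 2 ≤ φ y := by
  have := le_of_inner_gradient_sub_le (φ := fun z => -φ z) hφ.neg (c := -c) (fun x x' => by
    rw [gradient_fun_neg hφ, gradient_fun_neg hφ, ← neg_sub_neg]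
    have := h x x'
    simp only [neg_neg, inner_sub_left] at this ⊢
    linarith) x y
  rw [gradient_fun_neg hφ, inner_neg_left] at this
  linarith

/-- Co-coercivity of the gradient of a strongly convex smooth function. -/
theorem norm_sq_gradient_sub_le {φ : F → ℝ} (hφ : Differentiable ℝ φ) {μ L : ℝ} (hμ : 0 ≤ μ)
    (hL : 0 < L)
    (hs : ∀ x x', μ * ‖x - x'‖ ^ 2 ≤ inner ℝ (gradient φ x - gradient φ x') (x - x'))
    (hl : ∀ x x', ‖gradient φ x - gradient φ x'‖ ≤ L * ‖x - x'‖) (x y : F) :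
    ‖gradient φ x - gradient φ y - μ • (x - y)‖ ^ 2 ≤
      L * inner ℝ (gradient φ x - gradient φ y - μ • (x - y)) (x - y) := by
  have hup := le_of_inner_gradient_sub_le hφ (c := L) (fun x x' => by
    calc _ ≤ ‖gradient φ x - gradient φ x'‖ * ‖x - x'‖ := real_inner_le_norm _ _
      _ ≤ L * ‖x - x'‖ * ‖x - x'‖ := by gcongr; exact hl x x'
      _ = _ := by ring)
  have hlo := le_of_le_inner_gradient_sub hφ hs
  -- one half of the inequality
  have key : ∀ x y : F, φ x - inner ℝ (gradient φ y) (x - y) - φ y - μ / 2 * ‖x - y‖ ^ 2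
      ≥ 1 / (2 * L) * ‖gradient φ x - gradient φ y - μ • (x - y)‖ ^ 2 := by
    intro x y
    set e := gradient φ x - gradient φ y - μ • (x - y) with he
    -- The function minus its lower model at `y` has gradient `e` at `x`; both quadratic bounds are
    -- evaluated after a descent step along `e`. The step `1 / L` instead of `1 / (L - μ)` also
    -- covers `μ = L`.
    have h1 := hlo y (x - (1 / L) • e)
    have h2 := hup x (x - (1 / L) • e)
    have h3 : x - (1 / L) • e - y = (x - y) - (1 / L) • e := by abel
    have h4 : x - (1 / L) • e - x = -((1 / L) • e) := by abel
    rw [h3] at h1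
    rw [h4] at h2
    have hg : gradient φ x = e + gradient φ y + μ • (x - y) := by rw [he]; abel
    rw [norm_sub_sq_real, inner_sub_right] at h1
    rw [hg] at h2
    simp only [inner_neg_right, inner_smul_right, inner_add_left, real_inner_smul_left, norm_neg,
      norm_smul, real_inner_self_eq_norm_sq, norm_div, norm_one, Real.norm_of_nonneg hL.le] at h1 h2
    have h5 : 0 ≤ μ / 2 * (1 / L * ‖e‖) ^ 2 := by positivity
    have h6 : L / 2 * (1 / L * ‖e‖) ^ 2 = 1 / (2 * L) * ‖e‖ ^ 2 := by field_simp
    have h7 : 1 / L * ‖e‖ ^ 2 = 2 * (1 / (2 * L) * ‖e‖ ^ 2) := by field_simp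
    have h8 := real_inner_comm (x - y) e
    linarith
  have h1 := key x y
  have h2 := key y x
  have e1 : gradient φ y - gradient φ x - μ • (y - x) =
      -(gradient φ x - gradient φ y - μ • (x - y)) := by
    rw [smul_sub, smul_sub]; abel
  rw [e1, norm_neg, norm_sub_rev y x, ← neg_sub x y, inner_neg_right] at h2
  have h3 : 1 / L * ‖gradient φ x - gradient φ y - μ • (x - y)‖ ^ 2 ≤
      inner ℝ (gradient φ x - gradient φ y - μ • (x - y)) (x - y) := by
    rw [inner_sub_left, inner_sub_left, real_inner_smul_left, real_inner_self_eq_norm_sq]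
    have : 1 / L * ‖gradient φ x - gradient φ y - μ • (x - y)‖ ^ 2 =
      2 * (1 / (2 * L) * ‖gradient φ x - gradient φ y - μ • (x - y)‖ ^ 2) := by field_simp
    linarith
  calc _ = L * (1 / L * ‖gradient φ x - gradient φ y - μ • (x - y)‖ ^ 2) := by field_simp
    _ ≤ _ := by gcongr

/-- A gradient step of length at most `1 / (2 * L)` is a contraction. -/
theorem norm_sub_smul_gradient_sub_le {φ : F → ℝ} (hφ : Differentiable ℝ φ) {μ L α : ℝ}
    (hμ : 0 ≤ μ) (hL : 0 < L)
    (hs : ∀ x x', μ * ‖x - x'‖ ^ 2 ≤ inner ℝ (gradient φ x - gradient φ x') (x - x'))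
    (hl : ∀ x x', ‖gradient φ x - gradient φ x'‖ ≤ L * ‖x - x'‖) (hα : 0 ≤ α)
    (hαL : α * L ≤ 1 / 2) (hαμ : α * μ ≤ 1 / 2) (x y : F) :
    ‖x - y - α • (gradient φ x - gradient φ y)‖ ≤ (1 - α * μ) * ‖x - y‖ := by
  have hc := norm_sq_gradient_sub_le hφ hμ hL hs hl x y
  set e := gradient φ x - gradient φ y - μ • (x - y) with he
  have h1 : x - y - α • (gradient φ x - gradient φ y) = (1 - α * μ) • (x - y) - α • e := by
    rw [he, smul_sub α _ (μ • (x - y)), smul_smul, sub_smul, one_smul]; abel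
  rw [h1]
  have h0 : 0 ≤ 1 - α * μ := by linarith
  apply le_of_sq_le_sq _ (by positivity)
  rw [norm_sub_sq_real, norm_smul, norm_smul, inner_smul_left, inner_smul_right,
    Real.norm_of_nonneg h0, Real.norm_of_nonneg hα, real_inner_comm, mul_pow α]
  simp only [conj_trivial]
  have hnn : 0 ≤ inner ℝ e (x - y) :=
    nonneg_of_mul_nonneg_right ((sq_nonneg _).trans hc) hL
  have h2 : α ^ 2 * ‖e‖ ^ 2 ≤ α ^ 2 * (L * inner ℝ e (x - y)) := by gcongr
  -- The square `α²‖e‖²` is absorbed by the cross term, since `αL ≤ 1/2 ≤ 1 ≤ 2(1 - αμ)`.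
  have h3 : α * inner ℝ e (x - y) * (α * L) ≤ α * inner ℝ e (x - y) * (2 * (1 - α * μ)) :=
    mul_le_mul_of_nonneg_left (by linarith) (mul_nonneg hα hnn)
  nlinarith

end Convex

/-! ### Averages over the agents -/

section RowMean

variable {n p : ℕ}

theorem rowMean_add (x y : Fin n → EuclideanSpace ℝ (Fin p)) :
    rowMean (fun i => x i + y i) = rowMean x + rowMean y := by
  simp [rowMean, Finset.sum_add_distrib]

theorem rowMean_sub (x y : Fin n → EuclideanSpace ℝ (Fin p)) :
    rowMean (fun i => x i - y i) = rowMean x - rowMean y := by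
  simp [rowMean, Finset.sum_sub_distrib, smul_sub]

theorem rowMean_smul (c : ℝ) (x : Fin n → EuclideanSpace ℝ (Fin p)) :
    rowMean (fun i => c • x i) = c • rowMean x := by
  simp only [rowMean, ← Finset.smul_sum, smul_comm c]

theorem smul_rowMean (hn : 0 < n) (x : Fin n → EuclideanSpace ℝ (Fin p)) :
    (n : ℝ) • rowMean x = ∑ i, x i := by
  have : (n : ℝ) ≠ 0 := by positivity
  simp [rowMean, smul_smul, this]

theorem rowMean_const (hn : 0 < n) (c : EuclideanSpace ℝ (Fin p)) :
    rowMean (fun _ : Fin n => c) = c := by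
  have : (n : ℝ) ≠ 0 := by positivity
  simp [rowMean, ← Nat.cast_smul_eq_nsmul ℝ, smul_smul, this]

theorem sum_sub_rowMean (hn : 0 < n) (x : Fin n → EuclideanSpace ℝ (Fin p)) :
    ∑ i, (x i - rowMean x) = 0 := by
  rw [Finset.sum_sub_distrib, ← smul_rowMean hn]
  simp [← Nat.cast_smul_eq_nsmul ℝ]

theorem norm_rowMean_le (x : Fin n → EuclideanSpace ℝ (Fin p)) :
    ‖rowMean x‖ ≤ 1 / n * ∑ i, ‖x i‖ := by
  rw [rowMean, norm_smul, Real.norm_of_nonneg (by positivity)]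
  gcongr
  exact norm_sum_le _ _

theorem mul_norm_sq_rowMean_le (hn : 0 < n) (x : Fin n → EuclideanSpace ℝ (Fin p)) :
    n * ‖rowMean x‖ ^ 2 ≤ ∑ i, ‖x i‖ ^ 2 := by
  have hn' : (0 : ℝ) < n := by positivity
  have h1 : ‖rowMean x‖ ^ 2 ≤ (1 / n * ∑ i, ‖x i‖) ^ 2 := by
    gcongr; exact norm_rowMean_le x
  have h2 := sq_sum_le_card_mul_sum_sq (s := Finset.univ) (f := fun i => ‖x i‖)
  rw [Finset.card_univ, Fintype.card_fin] at h2
  calc _ ≤ n * (1 / n * ∑ i, ‖x i‖) ^ 2 := by gcongr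
    _ = 1 / n * (∑ i, ‖x i‖) ^ 2 := by field_simp
    _ ≤ 1 / n * (n * ∑ i, ‖x i‖ ^ 2) := by gcongr
    _ = _ := by field_simp

/-- Removing the mean decreases the sum of squares. -/
theorem sum_norm_sq_sub_rowMean (hn : 0 < n) (x : Fin n → EuclideanSpace ℝ (Fin p)) :
    consensusSq x = ∑ i, ‖x i‖ ^ 2 - n * ‖rowMean x‖ ^ 2 := by
  simp only [consensusSq, norm_sub_sq_real, Finset.sum_add_distrib, Finset.sum_sub_distrib]
  rw [← Finset.mul_sum, ← sum_inner, ← smul_rowMean hn, real_inner_smul_left,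
    real_inner_self_eq_norm_sq]
  simp
  ring

/-- A step along the averaged gradients is a contraction towards the minimizer. -/
theorem norm_sub_smul_rowMean_gradient_le (hn : 0 < n) {f : Fin n → EuclideanSpace ℝ (Fin p) → ℝ}
    {μ L α : ℝ} (hf : ∀ i, IsStronglyConvexSmooth (f i) μ L) (hμ : 0 ≤ μ) (hL : 0 < L)
    (hα : 0 ≤ α) (hαL : α * L ≤ 1 / 2) (hαμ : α * μ ≤ 1 / 2) (x y : EuclideanSpace ℝ (Fin p)) :
    ‖x - y - α • rowMean (fun i => gradient (f i) x - gradient (f i) y)‖ ≤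
      (1 - α * μ) * ‖x - y‖ := by
  have h1 : x - y - α • rowMean (fun i => gradient (f i) x - gradient (f i) y) =
      rowMean (fun i => x - y - α • (gradient (f i) x - gradient (f i) y)) := by
    rw [rowMean_sub (fun _ => x - y), rowMean_const hn, rowMean_smul]
  rw [h1]
  calc _ ≤ 1 / n * ∑ i, ‖x - y - α • (gradient (f i) x - gradient (f i) y)‖ :=
        norm_rowMean_le _
    _ ≤ 1 / n * ∑ i : Fin n, (1 - α * μ) * ‖x - y‖ := by
        gcongr with i
        exact norm_sub_smul_gradient_sub_le (hf i).differentiable hμ hL (hf i).strong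
          (hf i).lipschitz hα hαL hαμ x y
    _ = _ := by
        have : (n : ℝ) ≠ 0 := by positivity
        simp
        field_simp

/-- The gradients add up to zero at a minimizer of the average. -/
theorem rowMean_gradient_eq_zero {f : Fin n → EuclideanSpace ℝ (Fin p) → ℝ}
    (hf : ∀ i, Differentiable ℝ (f i)) {xs : EuclideanSpace ℝ (Fin p)}
    (hxs : ∀ x, (1 / (n : ℝ)) * ∑ i, f i xs ≤ (1 / (n : ℝ)) * ∑ i, f i x) :
    rowMean (fun i => gradient (f i) xs) = 0 := by
  have h1 : HasFDerivAt (fun x => (1 / (n : ℝ)) * ∑ i, f i x)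
      ((1 / (n : ℝ)) • ∑ i, fderiv ℝ (f i) xs) xs :=
    (HasFDerivAt.fun_sum fun i _ => (hf i xs).hasFDerivAt).const_mul _
  have h2 : IsLocalMin (fun x => (1 / (n : ℝ)) * ∑ i, f i x) xs :=
    Filter.Eventually.of_forall hxs
  have h3 := h2.hasFDerivAt_eq_zero h1
  have h4 := congrArg (InnerProductSpace.toDual ℝ (EuclideanSpace ℝ (Fin p))).symm h3
  simpa [rowMean, gradient, map_smul, map_sum] using h4

/-- Gives `L > 0`, which is not assumed. A nonzero vector is needed: in dimension zero nothing
constrains `L`. -/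
theorem mu_le_lipschitz (hp : 1 ≤ p) {φ : EuclideanSpace ℝ (Fin p) → ℝ} {μ L : ℝ}
    (hf : IsStronglyConvexSmooth φ μ L) : μ ≤ L := by
  have : Nonempty (Fin p) := ⟨⟨0, hp⟩⟩
  obtain ⟨x, hx⟩ := exists_ne (0 : EuclideanSpace ℝ (Fin p))
  have h1 := hf.strong x 0
  have h2 := real_inner_le_norm (gradient φ x - gradient φ 0) (x - 0)
  have h3 := hf.lipschitz x 0
  have h4 : 0 < ‖x - 0‖ := by simpa using hx
  have h5 : ‖gradient φ x - gradient φ 0‖ * ‖x - 0‖ ≤ L * ‖x - 0‖ * ‖x - 0‖ := by gcongr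
  have h6 : μ * ‖x - 0‖ ^ 2 ≤ L * ‖x - 0‖ ^ 2 := by linarith
  exact le_of_mul_le_mul_right h6 (by positivity)

end RowMean

/-! ### The action of the coupling matrix -/

section Mixing

variable {n p : ℕ} {W : Matrix (Fin n) (Fin n) ℝ}

open scoped Matrix.Norms.L2Operator in
/-- The spectral norm bounds the action of a matrix on families of vectors. -/
theorem sum_norm_sq_sum_smul_le (B : Matrix (Fin n) (Fin n) ℝ)
    (z : Fin n → EuclideanSpace ℝ (Fin p)) :
    ∑ i, ‖∑ j, B i j • z j‖ ^ 2 ≤ ‖B‖ ^ 2 * ∑ i, ‖z i‖ ^ 2 := by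
  simp only [EuclideanSpace.norm_sq_eq]
  -- For each coordinate in `ℝᵖ`, the entries form one vector indexed by the agents, to which the
  -- operator norm applies.
  rw [Finset.sum_comm, Finset.sum_comm (f := fun i j => ‖z i j‖ ^ 2), Finset.mul_sum]
  refine Finset.sum_le_sum fun c _ => ?_
  have h := Matrix.l2_opNorm_mulVec B (WithLp.toLp 2 fun j => z j c)
  have h2 := pow_le_pow_left₀ (norm_nonneg _) h 2
  rw [mul_pow, EuclideanSpace.norm_sq_eq, EuclideanSpace.norm_sq_eq] at h2
  simpa [Matrix.mulVec, dotProduct] using h2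

open scoped Matrix.Norms.Frobenius in
/-- The Frobenius norm bounds the action of a matrix on families of vectors. -/
theorem sum_norm_sq_sum_smul_le_frobenius (B : Matrix (Fin n) (Fin n) ℝ)
    (z : Fin n → EuclideanSpace ℝ (Fin p)) :
    ∑ i, ‖∑ j, B i j • z j‖ ^ 2 ≤ ‖B‖ ^ 2 * ∑ i, ‖z i‖ ^ 2 := by
  have hB : ‖B‖ ^ 2 = ∑ i, ∑ j, B i j ^ 2 := by
    have h0 : 0 ≤ ∑ i, ∑ j, B i j ^ 2 := by positivity
    rw [Matrix.frobenius_norm_def]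
    simp only [Real.rpow_two, Real.norm_eq_abs, sq_abs]
    rw [← Real.sqrt_eq_rpow, Real.sq_sqrt h0]
  rw [hB, Finset.sum_mul]
  refine Finset.sum_le_sum fun i _ => ?_
  calc ‖∑ j, B i j • z j‖ ^ 2 ≤ (∑ j, |B i j| * ‖z j‖) ^ 2 := by
        gcongr
        refine (norm_sum_le _ _).trans_eq ?_
        simp [norm_smul]
    _ ≤ (∑ j, |B i j| ^ 2) * ∑ j, ‖z j‖ ^ 2 := Finset.sum_mul_sq_le_sq_mul_sq _ _ _
    _ = _ := by simp

theorem sum_mix (hW : ∀ j, ∑ i, W i j = 1) (z : Fin n → EuclideanSpace ℝ (Fin p)) :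
    ∑ i, ∑ j, W i j • z j = ∑ i, z i := by
  rw [Finset.sum_comm]
  simp [← Finset.sum_smul, hW]

theorem rowMean_mix (hW : ∀ j, ∑ i, W i j = 1) (z : Fin n → EuclideanSpace ℝ (Fin p)) :
    rowMean (fun i => ∑ j, W i j • z j) = rowMean z := by
  simp [rowMean, sum_mix hW]

/-- A doubly stochastic matrix does not increase the sum of squares. -/
theorem sum_norm_sq_mix_le (h0 : ∀ i j, 0 ≤ W i j) (hr : ∀ i, ∑ j, W i j = 1)
    (hc : ∀ j, ∑ i, W i j = 1) (z : Fin n → EuclideanSpace ℝ (Fin p)) :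
    ∑ i, ‖∑ j, W i j • z j‖ ^ 2 ≤ ∑ i, ‖z i‖ ^ 2 := by
  have h1 : ∀ i, ‖∑ j, W i j • z j‖ ^ 2 ≤ ∑ j, W i j * ‖z j‖ ^ 2 := by
    intro i
    calc ‖∑ j, W i j • z j‖ ^ 2 ≤ (∑ j, W i j * ‖z j‖) ^ 2 := by
          gcongr
          refine (norm_sum_le _ _).trans_eq ?_
          simp [norm_smul, abs_of_nonneg (h0 _ _)]
      _ ≤ ∑ j, W i j * ‖z j‖ ^ 2 :=
        Real.pow_arith_mean_le_arith_mean_pow _ _ _ (fun j _ => h0 i j) (hr i)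
          (fun j _ => norm_nonneg _) 2
  calc _ ≤ ∑ i, ∑ j, W i j * ‖z j‖ ^ 2 := Finset.sum_le_sum fun i _ => h1 i
    _ = _ := by
      rw [Finset.sum_comm]
      simp [← Finset.sum_mul, hc]

/-- The averaging matrix kills families with zero sum and `W` fixes constant families, so the
contraction can be measured from the mean. -/
theorem mix_sub_rowMean (hn : 0 < n) (hr : ∀ i, ∑ j, W i j = 1)
    (z : Fin n → EuclideanSpace ℝ (Fin p)) (i : Fin n) :
    ∑ j, (W - Matrix.of (fun _ _ : Fin n => 1 / (n : ℝ))) i j • (z j - rowMean z) =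
      ∑ j, W i j • z j - rowMean z := by
  have h := sum_sub_rowMean hn z
  simp only [Matrix.sub_apply, Matrix.of_apply, sub_smul, Finset.sum_sub_distrib]
  rw [← Finset.smul_sum, h, smul_zero, sub_zero]
  simp only [smul_sub, Finset.sum_sub_distrib, ← Finset.sum_smul, hr, one_smul]

/-- Mixing contracts the distance to consensus by the factor `rhoW W`. -/
theorem sum_norm_sq_mix_sub_rowMean_le (hn : 0 < n) (hr : ∀ i, ∑ j, W i j = 1)
    (z : Fin n → EuclideanSpace ℝ (Fin p)) :
    ∑ i, ‖∑ j, W i j • z j - rowMean z‖ ^ 2 ≤ rhoW W ^ 2 * consensusSq z := by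
  have h := sum_norm_sq_sum_smul_le (W - Matrix.of (fun _ _ : Fin n => 1 / (n : ℝ)))
    (fun j => z j - rowMean z)
  simp only [mix_sub_rowMean hn hr] at h
  exact h

theorem sum_sub_one_smul (hr : ∀ i, ∑ j, W i j = 1) (z : Fin n → EuclideanSpace ℝ (Fin p))
    (c : EuclideanSpace ℝ (Fin p)) (i : Fin n) :
    ∑ j, (W - 1) i j • (z j - c) = ∑ j, W i j • z j - z i := by
  simp only [Matrix.sub_apply, sub_smul, Finset.sum_sub_distrib, smul_sub, ← Finset.sum_smul, hr,
    Matrix.one_apply]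
  simp

/-- Since `W - 1` annihilates constant families, only the deviation from the mean matters. -/
theorem sum_norm_sq_mix_sub_self_le (hr : ∀ i, ∑ j, W i j = 1)
    (z : Fin n → EuclideanSpace ℝ (Fin p)) :
    ∑ i, ‖∑ j, W i j • z j - z i‖ ^ 2 ≤ distI W ^ 2 * consensusSq z := by
  have h := sum_norm_sq_sum_smul_le_frobenius (W - 1) (fun j => z j - rowMean z)
  simp only [sum_sub_one_smul hr] at h
  exact h

/-- Matrices carry several norms, so the instance is given explicitly. -/
theorem rhoW_nonneg : 0 ≤ rhoW W := by
  unfold rhoW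
  exact @norm_nonneg _ (Matrix.instL2OpNormedAddCommGroup.toSeminormedAddCommGroup.toSeminormedAddGroup) _

theorem distI_nonneg : 0 ≤ distI W := by
  unfold distI
  exact @norm_nonneg _ (Matrix.frobeniusNormedAddCommGroup.toSeminormedAddCommGroup.toSeminormedAddGroup) _

-- Subtracting the averaging matrix amounts to removing the mean before applying `W`. Removing the
-- mean is an orthogonal projection, and `W` does not increase the sum of squares by convexity.
open scoped Matrix.Norms.L2Operator in
theorem rhoW_le_one (hn : 0 < n) (h0 : ∀ i j, 0 ≤ W i j) (hr : ∀ i, ∑ j, W i j = 1)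
    (hc : ∀ j, ∑ i, W i j = 1) : rhoW W ≤ 1 := by
  unfold rhoW
  rw [Matrix.l2_opNorm_def]
  refine ContinuousLinearMap.opNorm_le_bound _ zero_le_one fun x => ?_
  rw [one_mul]
  apply le_of_sq_le_sq _ (norm_nonneg _)
  -- regard the entries of `x` as vectors of dimension one
  let z : Fin n → EuclideanSpace ℝ (Fin 1) := fun j => WithLp.toLp 2 fun _ => x j
  have hz : ∀ i, ∑ j, W i j • z j - rowMean z =
      ∑ j, (W - Matrix.of (fun _ _ : Fin n => 1 / (n : ℝ))) i j • z j := by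
    intro i
    simp [rowMean, sub_smul, Finset.sum_sub_distrib, Finset.smul_sum]
  have h1 := sum_norm_sq_mix_le h0 hr hc (fun j => z j - rowMean z)
  simp only [smul_sub, Finset.sum_sub_distrib, ← Finset.sum_smul, hr, one_smul, hz] at h1
  have h2 : ∑ i, ‖z i - rowMean z‖ ^ 2 ≤ ∑ i, ‖z i‖ ^ 2 := by
    have := sum_norm_sq_sub_rowMean hn z
    rw [consensusSq] at this
    rw [this]
    have : 0 ≤ n * ‖rowMean z‖ ^ 2 := by positivity
    linarith
  have h3 := h1.trans h2
  simp only [EuclideanSpace.norm_sq_eq] at h3 ⊢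
  simpa [z, Matrix.mulVec, dotProduct, sub_mul, Finset.sum_sub_distrib] using h3

end Mixing

/-! ### Young's inequality -/

section Young

variable {F : Type*} [NormedAddCommGroup F] [InnerProductSpace ℝ F]

theorem two_inner_le (a b : F) {c : ℝ} (hc : 0 < c) :
    2 * inner ℝ a b ≤ c * ‖a‖ ^ 2 + 1 / c * ‖b‖ ^ 2 := by
  have h := sq_nonneg ‖c • a - b‖
  rw [norm_sub_sq_real, norm_smul, real_inner_smul_left, Real.norm_of_nonneg hc.le] at h
  have h2 : c * (2 * inner ℝ a b) ≤ c * (c * ‖a‖ ^ 2 + 1 / c * ‖b‖ ^ 2) := by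
    have : c * (1 / c * ‖b‖ ^ 2) = ‖b‖ ^ 2 := by field_simp
    rw [mul_add, this]; linarith
  exact le_of_mul_le_mul_left h2 hc

theorem norm_add_sq_le (a b : F) {c : ℝ} (hc : 0 < c) :
    ‖a + b‖ ^ 2 ≤ (1 + c) * ‖a‖ ^ 2 + (1 + 1 / c) * ‖b‖ ^ 2 := by
  rw [norm_add_sq_real]
  linarith [two_inner_le a b hc]

theorem norm_sub_sq_le (a b : F) {c : ℝ} (hc : 0 < c) :
    ‖a - b‖ ^ 2 ≤ (1 + c) * ‖a‖ ^ 2 + (1 + 1 / c) * ‖b‖ ^ 2 := by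
  rw [sub_eq_add_neg, ← norm_neg b]
  exact norm_add_sq_le a (-b) hc

end Young

/-! ### One step of each error along a fixed realization -/

section Pathwise

variable {n p : ℕ} {W : Matrix (Fin n) (Fin n) ℝ} {α μ L : ℝ}

/-- One step of the averaged iterate, perturbed by the noise `N`. -/
theorem optimality_step (hn : 0 < n) {f : Fin n → EuclideanSpace ℝ (Fin p) → ℝ}
    (hf : ∀ i, IsStronglyConvexSmooth (f i) μ L) (hμ : 0 < μ) (hL : 0 < L)
    (hα : 0 < α) (hαL : α * L ≤ 1 / 2) (hαμ : α * μ ≤ 1 / 2) {xs : EuclideanSpace ℝ (Fin p)}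
    (hxs : rowMean (fun i => gradient (f i) xs) = 0) (x : Fin n → EuclideanSpace ℝ (Fin p))
    (N : EuclideanSpace ℝ (Fin p)) :
    ‖rowMean x - α • (rowMean (fun i => gradient (f i) (x i)) + N) - xs‖ ^ 2 ≤
      (1 - α * μ) * ‖rowMean x - xs‖ ^ 2 + α * L ^ 2 / (μ * n) * (1 + α * μ) * consensusSq x
      - 2 * α * inner ℝ (rowMean x - α • rowMean (fun i => gradient (f i) (x i)) - xs) N
      + α ^ 2 * ‖N‖ ^ 2 := by
  have hn' : (0 : ℝ) < n := by positivity
  set z := rowMean x - α • rowMean (fun i => gradient (f i) (x i)) - xs with hz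
  have e1 : rowMean x - α • (rowMean (fun i => gradient (f i) (x i)) + N) - xs = z - α • N := by
    rw [hz, smul_add]; abel
  set a := rowMean x - xs - α • rowMean (fun i => gradient (f i) (rowMean x) - gradient (f i) xs)
    with ha
  set b := rowMean (fun i => gradient (f i) (rowMean x) - gradient (f i) (x i)) with hb
  -- Here `a` is a gradient step taken at the mean, and `b` the error from evaluating the gradients
  -- at the agents' own points.
  have e2 : z = a + α • b := by
    rw [hz, ha, hb, rowMean_sub, rowMean_sub, hxs]
    module
  have h1 : ‖a‖ ^ 2 ≤ ((1 - α * μ) * ‖rowMean x - xs‖) ^ 2 := by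
    gcongr
    exact norm_sub_smul_rowMean_gradient_le hn hf hμ.le hL hα.le hαL hαμ _ _
  have h2 : n * ‖b‖ ^ 2 ≤ L ^ 2 * consensusSq x := by
    refine (mul_norm_sq_rowMean_le hn _).trans ?_
    rw [consensusSq, Finset.mul_sum]
    refine Finset.sum_le_sum fun i _ => ?_
    rw [← mul_pow, norm_sub_rev (x i)]
    gcongr
    exact (hf i).lipschitz _ _
  have h3 : ‖b‖ ^ 2 ≤ L ^ 2 / n * consensusSq x := by
    rw [div_mul_eq_mul_div, le_div_iff₀ hn']; linarith
  -- Young's parameter `αμ`: the contraction `(1 - αμ)²` pays for the factor `1 + αμ` and still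
  -- leaves `1 - αμ`.
  have hc : 0 < α * μ := by positivity
  have h4 := norm_add_sq_le a (α • b) hc
  rw [norm_smul, Real.norm_of_nonneg hα.le, mul_pow] at h4
  have h5 : ‖z‖ ^ 2 ≤ (1 - α * μ) * ‖rowMean x - xs‖ ^ 2 +
      α * L ^ 2 / (μ * n) * (1 + α * μ) * consensusSq x := by
    rw [e2]
    refine h4.trans ?_
    have h6 : (1 + α * μ) * ‖a‖ ^ 2 ≤ (1 - α * μ) * ‖rowMean x - xs‖ ^ 2 := by
      calc (1 + α * μ) * ‖a‖ ^ 2 ≤ (1 + α * μ) * ((1 - α * μ) * ‖rowMean x - xs‖) ^ 2 := by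
            gcongr
        _ = ((1 - α * μ) * ‖rowMean x - xs‖ ^ 2) * (1 - (α * μ) ^ 2) := by ring
        _ ≤ ((1 - α * μ) * ‖rowMean x - xs‖ ^ 2) * 1 := by
            apply mul_le_mul_of_nonneg_left (by nlinarith)
            exact mul_nonneg (by linarith) (sq_nonneg _)
        _ = _ := by ring
    have h7 : (1 + 1 / (α * μ)) * (α ^ 2 * ‖b‖ ^ 2) ≤
        α * L ^ 2 / (μ * n) * (1 + α * μ) * consensusSq x := by
      calc _ ≤ (1 + 1 / (α * μ)) * (α ^ 2 * (L ^ 2 / n * consensusSq x)) := by gcongr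
        _ = _ := by field_simp; ring
    linarith
  rw [e1, norm_sub_sq_real, norm_smul, Real.norm_of_nonneg hα.le, inner_smul_right, mul_pow]
  linarith

theorem sum_mix_sub_rowMean (hn : 0 < n) (hc : ∀ j, ∑ i, W i j = 1)
    (z : Fin n → EuclideanSpace ℝ (Fin p)) : ∑ i, (∑ j, W i j • z j - rowMean z) = 0 := by
  have h := sum_sub_rowMean hn (fun i => ∑ j, W i j • z j)
  rwa [rowMean_mix hc] at h

theorem mix_step_sub_rowMean (hc : ∀ j, ∑ i, W i j = 1)
    (x y : Fin n → EuclideanSpace ℝ (Fin p)) (i : Fin n) :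
    ∑ j, W i j • (x j - α • y j) - rowMean (fun i => ∑ j, W i j • (x j - α • y j)) =
      (∑ j, W i j • x j - rowMean x) - α • (∑ j, W i j • y j - rowMean y) := by
  rw [rowMean_mix hc, rowMean_sub, rowMean_smul]
  simp only [smul_sub, Finset.sum_sub_distrib, Finset.smul_sum, smul_comm α]
  abel

/-- One step of the consensus error. -/
theorem consensus_step (hn : 0 < n) (hr : ∀ i, ∑ j, W i j = 1) (hc : ∀ j, ∑ i, W i j = 1)
    (h0 : rhoW W ≠ 0) (h1 : rhoW W < 1) (x y : Fin n → EuclideanSpace ℝ (Fin p)) :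
    consensusSq (fun i => ∑ j, W i j • (x j - α • y j)) ≤
      (1 + rhoW W ^ 2) / 2 * consensusSq x +
      α ^ 2 * ((1 + rhoW W ^ 2) * rhoW W ^ 2 / (1 - rhoW W ^ 2)) * consensusSq y := by
  set ρ := rhoW W
  have hρ : 0 < ρ := lt_of_le_of_ne rhoW_nonneg (Ne.symm h0)
  have hρ1 : 0 < 1 - ρ ^ 2 := by nlinarith
  -- This parameter `c` satisfies `(1 + c)ρ² = (1 + ρ²)/2` and `1 + 1/c = (1 + ρ²)/(1 - ρ²)`.
  have hcpos : 0 < (1 - ρ ^ 2) / (2 * ρ ^ 2) := by positivity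
  have hx := sum_norm_sq_mix_sub_rowMean_le hn hr x
  have hy := sum_norm_sq_mix_sub_rowMean_le hn hr y
  have e : consensusSq (fun i => ∑ j, W i j • (x j - α • y j)) =
      ∑ i, ‖(∑ j, W i j • x j - rowMean x) - α • (∑ j, W i j • y j - rowMean y)‖ ^ 2 :=
    Finset.sum_congr rfl fun i _ => by rw [mix_step_sub_rowMean hc]
  rw [e]
  calc _ ≤ ∑ i, ((1 + (1 - ρ ^ 2) / (2 * ρ ^ 2)) * ‖∑ j, W i j • x j - rowMean x‖ ^ 2 +
        (1 + 1 / ((1 - ρ ^ 2) / (2 * ρ ^ 2))) * ‖α • (∑ j, W i j • y j - rowMean y)‖ ^ 2) :=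
        Finset.sum_le_sum fun i _ => norm_sub_sq_le _ _ hcpos
    _ = (1 + (1 - ρ ^ 2) / (2 * ρ ^ 2)) * ∑ i, ‖∑ j, W i j • x j - rowMean x‖ ^ 2 +
        (1 + 1 / ((1 - ρ ^ 2) / (2 * ρ ^ 2))) * (α ^ 2 *
          ∑ i, ‖∑ j, W i j • y j - rowMean y‖ ^ 2) := by
        simp only [norm_smul, mul_pow, Finset.sum_add_distrib, Finset.mul_sum, Real.norm_eq_abs,
          sq_abs]
    _ ≤ (1 + (1 - ρ ^ 2) / (2 * ρ ^ 2)) * (ρ ^ 2 * consensusSq x) +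
        (1 + 1 / ((1 - ρ ^ 2) / (2 * ρ ^ 2))) * (α ^ 2 * (ρ ^ 2 * consensusSq y)) := by
        gcongr
    _ = _ := by field_simp; ring

/-- If `rhoW W = 0`, one mixing step reaches consensus. -/
theorem consensusSq_mix_eq_zero (hn : 0 < n) (hr : ∀ i, ∑ j, W i j = 1)
    (hc : ∀ j, ∑ i, W i j = 1) (h0 : rhoW W = 0) (z : Fin n → EuclideanSpace ℝ (Fin p)) :
    consensusSq (fun i => ∑ j, W i j • z j) = 0 := by
  have h := sum_norm_sq_mix_sub_rowMean_le hn hr z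
  rw [h0] at h
  have e : consensusSq (fun i => ∑ j, W i j • z j) = ∑ i, ‖∑ j, W i j • z j - rowMean z‖ ^ 2 :=
    Finset.sum_congr rfl fun i _ => by rw [rowMean_mix hc]
  rw [e]
  refine le_antisymm (by linarith) (by positivity)

/-- The averaged gradient is controlled by the distance to consensus and to the minimizer. -/
theorem mul_norm_sq_rowMean_apply_le (hn : 0 < n)
    {h : Fin n → EuclideanSpace ℝ (Fin p) → EuclideanSpace ℝ (Fin p)}
    (hl : ∀ i a b, ‖h i a - h i b‖ ≤ L * ‖a - b‖) {xs : EuclideanSpace ℝ (Fin p)}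
    (hxs : rowMean (fun i => h i xs) = 0) (x : Fin n → EuclideanSpace ℝ (Fin p)) :
    n * ‖rowMean (fun i => h i (x i))‖ ^ 2 ≤
      2 * L ^ 2 * consensusSq x + 2 * n * L ^ 2 * ‖rowMean x - xs‖ ^ 2 := by
  have e : rowMean (fun i => h i (x i)) = rowMean (fun i => h i (x i) - h i xs) := by
    rw [rowMean_sub, hxs, sub_zero]
  rw [e]
  refine (mul_norm_sq_rowMean_le hn _).trans ?_
  calc ∑ i, ‖h i (x i) - h i xs‖ ^ 2
      ≤ ∑ i, L ^ 2 * (2 * ‖x i - rowMean x‖ ^ 2 + 2 * ‖rowMean x - xs‖ ^ 2) := by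
        refine Finset.sum_le_sum fun i _ => ?_
        have h1 := norm_add_sq_le (x i - rowMean x) (rowMean x - xs) one_pos
        rw [sub_add_sub_cancel] at h1
        calc _ ≤ (L * ‖x i - xs‖) ^ 2 := by gcongr; exact hl _ _ _
          _ = L ^ 2 * ‖x i - xs‖ ^ 2 := by ring
          _ ≤ _ := by gcongr; linarith
    _ = _ := by
        simp only [consensusSq, ← Finset.mul_sum, Finset.sum_add_distrib]
        simp
        ring

/-- The length of a step of the iterates. -/
theorem sum_norm_sq_mix_step_sub_le (hn : 0 < n) (hr : ∀ i, ∑ j, W i j = 1)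
    (hc : ∀ j, ∑ i, W i j = 1) (x y : Fin n → EuclideanSpace ℝ (Fin p)) :
    ∑ i, ‖∑ j, W i j • (x j - α • y j) - x i‖ ^ 2 ≤ 2 * distI W ^ 2 * consensusSq x +
      2 * α ^ 2 * ∑ i, ‖∑ j, W i j • y j - rowMean y‖ ^ 2 + α ^ 2 * (n * ‖rowMean y‖ ^ 2) := by
  set u : Fin n → EuclideanSpace ℝ (Fin p) := fun i => ∑ j, W i j • y j - rowMean y with hu
  set q : Fin n → EuclideanSpace ℝ (Fin p) := fun i => ∑ j, W i j • x j - x i with hq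
  have e : ∀ i, ∑ j, W i j • (x j - α • y j) - x i = (q i - α • u i) - α • rowMean y := by
    intro i
    simp only [hq, hu, smul_sub, Finset.sum_sub_distrib, Finset.smul_sum, smul_comm α]
    abel
  -- Zero sum makes this part orthogonal to the common displacement `α • rowMean y`, so no cross
  -- term appears.
  have hsum : ∑ i, (q i - α • u i) = 0 := by
    rw [Finset.sum_sub_distrib, ← Finset.smul_sum, sum_mix_sub_rowMean hn hc, smul_zero, sub_zero,
      Finset.sum_sub_distrib, sum_mix hc, sub_self]
  have h1 : ∑ i, ‖∑ j, W i j • (x j - α • y j) - x i‖ ^ 2 =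
      ∑ i, ‖q i - α • u i‖ ^ 2 + α ^ 2 * (n * ‖rowMean y‖ ^ 2) := by
    simp only [e]
    simp only [norm_sub_sq_real _ (α • rowMean y), Finset.sum_add_distrib,
      Finset.sum_sub_distrib, ← Finset.mul_sum]
    rw [← sum_inner, hsum, inner_zero_left, norm_smul, mul_pow]
    simp
    ring
  rw [h1]
  have h2 : ∑ i, ‖q i - α • u i‖ ^ 2 ≤ 2 * ∑ i, ‖q i‖ ^ 2 + 2 * α ^ 2 * ∑ i, ‖u i‖ ^ 2 := by
    rw [Finset.mul_sum, Finset.mul_sum, ← Finset.sum_add_distrib]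
    refine Finset.sum_le_sum fun i _ => ?_
    have := norm_sub_sq_le (q i) (α • u i) one_pos
    rw [norm_smul, mul_pow, Real.norm_eq_abs, sq_abs] at this
    linarith
  have h3 := sum_norm_sq_mix_sub_self_le hr x
  linarith

/-- The change of a Lipschitz field in one step, tested against the mixed tracking error. -/
theorem sum_inner_mix_step_le (hr : ∀ i, ∑ j, W i j = 1)
    {h : Fin n → EuclideanSpace ℝ (Fin p) → EuclideanSpace ℝ (Fin p)}
    (hl : ∀ i a b, ‖h i a - h i b‖ ≤ L * ‖a - b‖) (hL : 0 ≤ L) (hα : 0 ≤ α) {β : ℝ} (hβ : 0 < β)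
    (x y : Fin n → EuclideanSpace ℝ (Fin p)) :
    2 * ∑ i, inner ℝ (∑ j, W i j • y j - rowMean y)
        (h i (∑ j, W i j • (x j - α • y j)) - h i (x i)) ≤
      (β + 4 * α * L) * ∑ i, ‖∑ j, W i j • y j - rowMean y‖ ^ 2 +
      1 / β * distI W ^ 2 * L ^ 2 * consensusSq x + α * L / 2 * (n * ‖rowMean y‖ ^ 2) := by
  set u : Fin n → EuclideanSpace ℝ (Fin p) := fun i => ∑ j, W i j • y j - rowMean y with hu
  set q : Fin n → EuclideanSpace ℝ (Fin p) := fun i => ∑ j, W i j • x j - x i with hq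
  have key : ∀ i, 2 * inner ℝ (u i) (h i (∑ j, W i j • (x j - α • y j)) - h i (x i)) ≤
      (β + 4 * α * L) * ‖u i‖ ^ 2 + 1 / β * L ^ 2 * ‖q i‖ ^ 2 +
        α * L / 2 * ‖rowMean y‖ ^ 2 := by
    intro i
    have e : ∑ j, W i j • (x j - α • y j) - x i = q i - α • u i - α • rowMean y := by
      simp only [hq, hu, smul_sub, Finset.sum_sub_distrib, Finset.smul_sum, smul_comm α]
      abel
    have h1 : ‖∑ j, W i j • (x j - α • y j) - x i‖ ≤
        ‖q i‖ + α * ‖u i‖ + α * ‖rowMean y‖ := by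
      rw [e]
      refine (norm_sub_le _ _).trans (add_le_add ((norm_sub_le _ _).trans ?_) ?_) <;>
      simp [norm_smul, abs_of_nonneg hα]
    have h2 : inner ℝ (u i) (h i (∑ j, W i j • (x j - α • y j)) - h i (x i)) ≤
        ‖u i‖ * (L * (‖q i‖ + α * ‖u i‖ + α * ‖rowMean y‖)) := by
      refine (real_inner_le_norm _ _).trans ?_
      gcongr
      exact (hl _ _ _).trans (by gcongr)
    have h3 : 2 * (‖u i‖ * (L * ‖q i‖)) ≤ β * ‖u i‖ ^ 2 + 1 / β * (L * ‖q i‖) ^ 2 := by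
      have := two_inner_le (‖u i‖ : ℝ) (L * ‖q i‖ : ℝ) hβ
      simp only [RCLike.inner_apply, conj_trivial, Real.norm_eq_abs, sq_abs] at this
      linarith
    -- With weights 2 and 1/2 the coefficient of `‖u i‖²` is `2αL` from here plus `2αL` from the
    -- `α‖u i‖` part of the step.
    have h4 : α * L * (2 * (‖u i‖ * ‖rowMean y‖)) ≤
        α * L * (2 * ‖u i‖ ^ 2 + 1 / 2 * ‖rowMean y‖ ^ 2) := by
      gcongr
      nlinarith [sq_nonneg (2 * ‖u i‖ - ‖rowMean y‖)]
    nlinarith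
  have h3 := sum_norm_sq_mix_sub_self_le hr x
  calc _ ≤ ∑ i, ((β + 4 * α * L) * ‖u i‖ ^ 2 + 1 / β * L ^ 2 * ‖q i‖ ^ 2 +
        α * L / 2 * ‖rowMean y‖ ^ 2) := by
        rw [Finset.mul_sum]; exact Finset.sum_le_sum fun i _ => key i
    _ = (β + 4 * α * L) * ∑ i, ‖u i‖ ^ 2 + 1 / β * L ^ 2 * ∑ i, ‖q i‖ ^ 2 +
        α * L / 2 * (n * ‖rowMean y‖ ^ 2) := by
        simp only [Finset.sum_add_distrib, ← Finset.mul_sum]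
        simp
    _ ≤ (β + 4 * α * L) * ∑ i, ‖u i‖ ^ 2 + 1 / β * L ^ 2 * (distI W ^ 2 * consensusSq x) +
        α * L / 2 * (n * ‖rowMean y‖ ^ 2) := by gcongr
    _ = _ := by ring

/-- The effect of the gradient noise `N` on the next gradients, tested against the noise. -/
theorem neg_sum_inner_mix_step_le (h0 : ∀ i j, 0 ≤ W i j) (hr : ∀ i, ∑ j, W i j = 1)
    (hc : ∀ j, ∑ i, W i j = 1)
    {h : Fin n → EuclideanSpace ℝ (Fin p) → EuclideanSpace ℝ (Fin p)}
    (hl : ∀ i a b, ‖h i a - h i b‖ ≤ L * ‖a - b‖) (hL : 0 ≤ L) (hα : 0 ≤ α)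
    (x y N : Fin n → EuclideanSpace ℝ (Fin p)) :
    -(2 * ∑ i, inner ℝ (h i (∑ j, W i j • (x j - α • y j)) - h i (x i)) (N i)) ≤
      2 * α * L * ∑ i, ‖N i‖ ^ 2 -
      2 * ∑ i, inner ℝ (h i (∑ j, W i j • (x j - α • (y j - N j))) - h i (x i)) (N i) := by
  have key : ∀ i, -(2 * inner ℝ (h i (∑ j, W i j • (x j - α • y j)) - h i (x i)) (N i)) ≤
      α * L * (‖∑ j, W i j • N j‖ ^ 2 + ‖N i‖ ^ 2) -
      2 * inner ℝ (h i (∑ j, W i j • (x j - α • (y j - N j))) - h i (x i)) (N i) := by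
    intro i
    set a := ∑ j, W i j • (x j - α • y j)
    -- The step without the current noise: its gradient will be uncorrelated with `N i`, and the
    -- difference from `a` is linear in the noise.
    set b := ∑ j, W i j • (x j - α • (y j - N j))
    have e : b - a = α • ∑ j, W i j • N j := by
      simp only [a, b, ← Finset.sum_sub_distrib, Finset.smul_sum]
      exact Finset.sum_congr rfl fun j _ => by module
    have h1 : inner ℝ (h i b - h i a) (N i) ≤ L * (α * ‖∑ j, W i j • N j‖) * ‖N i‖ := by
      refine (real_inner_le_norm _ _).trans ?_
      gcongr
      refine (hl _ _ _).trans ?_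
      rw [e, norm_smul, Real.norm_of_nonneg hα]
    have h2 : α * L * (2 * (‖∑ j, W i j • N j‖ * ‖N i‖)) ≤
        α * L * (‖∑ j, W i j • N j‖ ^ 2 + ‖N i‖ ^ 2) := by
      gcongr
      nlinarith [sq_nonneg (‖∑ j, W i j • N j‖ - ‖N i‖)]
    simp only [inner_sub_left] at h1 ⊢
    nlinarith
  have h1 := sum_norm_sq_mix_le h0 hr hc N
  calc _ = ∑ i, -(2 * inner ℝ (h i (∑ j, W i j • (x j - α • y j)) - h i (x i)) (N i)) := by
        rw [Finset.sum_neg_distrib, Finset.mul_sum]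
    _ ≤ _ := Finset.sum_le_sum fun i _ => key i
    _ = α * L * (∑ i, ‖∑ j, W i j • N j‖ ^ 2 + ∑ i, ‖N i‖ ^ 2) - 2 * ∑ i, inner ℝ
        (h i (∑ j, W i j • (x j - α • (y j - N j))) - h i (x i)) (N i) := by
        simp only [Finset.sum_sub_distrib, ← Finset.mul_sum, Finset.sum_add_distrib]
    _ ≤ α * L * (∑ i, ‖N i‖ ^ 2 + ∑ i, ‖N i‖ ^ 2) - 2 * ∑ i, inner ℝ
        (h i (∑ j, W i j • (x j - α • (y j - N j))) - h i (x i)) (N i) := by gcongr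
    _ = _ := by ring

theorem consensusSq_sub_const (hn : 0 < n) (x : Fin n → EuclideanSpace ℝ (Fin p))
    (c : EuclideanSpace ℝ (Fin p)) : consensusSq (fun i => x i - c) = consensusSq x := by
  unfold consensusSq
  rw [rowMean_sub x (fun _ => c), rowMean_const hn]
  simp only [sub_sub_sub_cancel_right]

/-- One step of the tracking error, where `N` and `N'` are the gradient noises before and after. -/
theorem tracking_step (hn : 0 < n) (h0 : ∀ i j, 0 ≤ W i j) (hr : ∀ i, ∑ j, W i j = 1)
    (hc : ∀ j, ∑ i, W i j = 1)
    {h : Fin n → EuclideanSpace ℝ (Fin p) → EuclideanSpace ℝ (Fin p)}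
    (hl : ∀ i a b, ‖h i a - h i b‖ ≤ L * ‖a - b‖) (hL : 0 < L) (hα : 0 < α)
    (hαL : α * L ≤ 1 / 2) {β : ℝ} (hβ : 0 < β) {xs : EuclideanSpace ℝ (Fin p)}
    (hxs : rowMean (fun i => h i xs) = 0)
    {x y N N' x' D u : Fin n → EuclideanSpace ℝ (Fin p)}
    (hy : rowMean y = rowMean (fun i => h i (x i)) + rowMean N)
    (hx' : ∀ i, x' i = ∑ j, W i j • (x j - α • y j)) (hD : ∀ i, D i = h i (x' i) - h i (x i))
    (hu : ∀ i, u i = ∑ j, W i j • y j - rowMean y) :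
    consensusSq (fun i => ∑ j, W i j • y j + (h i (x' i) + N' i) - (h i (x i) + N i)) ≤
      2 * α * n * L ^ 3 * ‖rowMean x - xs‖ ^ 2 +
      ((1 / β + 2) * distI W ^ 2 * L ^ 2 + 3 * α * L ^ 3) * consensusSq x +
      (1 + 4 * α * L + 2 * α ^ 2 * L ^ 2 + β) * rhoW W ^ 2 * consensusSq y +
      ((1 + 2 * α * L) * ∑ i, ‖N i‖ ^ 2 + ∑ i, ‖N' i‖ ^ 2 +
        2 * ∑ i, inner ℝ (u i + D i - N i) (N' i) - 2 * ∑ i, inner ℝ (u i) (N i) -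
        2 * ∑ i, inner ℝ (h i (∑ j, W i j • (x j - α • (y j - N j))) - h i (x i)) (N i) +
        α * L * (2 * (n * inner ℝ (rowMean (fun i => h i (x i))) (rowMean N)) +
          n * ‖rowMean N‖ ^ 2)) := by
  have hmean : ∀ i, ∑ j, W i j • y j + (h i (x' i) + N' i) - (h i (x i) + N i) - rowMean y =
      u i + D i - N i + N' i := by
    intro i; rw [hu, hD]; abel
  -- replacing the mean by another vector increases the sum of squares
  have h1 : consensusSq (fun i => ∑ j, W i j • y j + (h i (x' i) + N' i) - (h i (x i) + N i)) ≤
      ∑ i, ‖u i + D i - N i + N' i‖ ^ 2 - n * ‖rowMean (fun i => D i - N i + N' i)‖ ^ 2 := by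
    have e : consensusSq (fun i => ∑ j, W i j • y j + (h i (x' i) + N' i) - (h i (x i) + N i)) =
        consensusSq (fun i => u i + D i - N i + N' i) := by
      rw [show (fun i => u i + D i - N i + N' i) = fun i => (∑ j, W i j • y j +
        (h i (x' i) + N' i) - (h i (x i) + N i)) - rowMean y from funext fun i => (hmean i).symm]
      exact (consensusSq_sub_const hn _ _).symm
    rw [e, sum_norm_sq_sub_rowMean hn]
    have hu0 : rowMean u = 0 := by
      rw [show u = fun i => ∑ j, W i j • y j - rowMean y from funext hu, rowMean,
        sum_mix_sub_rowMean hn hc, smul_zero]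
    have : rowMean (fun i => u i + D i - N i + N' i) = rowMean (fun i => D i - N i + N' i) := by
      rw [show (fun i => u i + D i - N i + N' i) = fun i => u i + (D i - N i + N' i) from
        funext fun i => by abel, rowMean_add, hu0, zero_add]
    rw [this]
  have h2 : ∑ i, ‖u i + D i - N i + N' i‖ ^ 2 = ∑ i, ‖u i‖ ^ 2 + 2 * ∑ i, inner ℝ (u i) (D i) +
      ∑ i, ‖D i‖ ^ 2 + ∑ i, ‖N i‖ ^ 2 + ∑ i, ‖N' i‖ ^ 2 +
      2 * ∑ i, inner ℝ (u i + D i - N i) (N' i) - 2 * ∑ i, inner ℝ (u i) (N i) +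
      -(2 * ∑ i, inner ℝ (D i) (N i)) := by
    simp only [Finset.mul_sum, ← Finset.sum_add_distrib, ← Finset.sum_sub_distrib,
      ← Finset.sum_neg_distrib]
    refine Finset.sum_congr rfl fun i _ => ?_
    rw [norm_add_sq_real, norm_sub_sq_real, norm_add_sq_real, inner_add_left (u i) (D i) (N i)]
    ring
  have h3 : ∑ i, ‖D i‖ ^ 2 ≤ L ^ 2 * (2 * distI W ^ 2 * consensusSq x +
      2 * α ^ 2 * ∑ i, ‖u i‖ ^ 2 + α ^ 2 * (n * ‖rowMean y‖ ^ 2)) := by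
    have := sum_norm_sq_mix_step_sub_le (α := α) hn hr hc x y
    simp only [← hx', ← hu] at this
    refine le_trans ?_ (mul_le_mul_of_nonneg_left this (by positivity))
    rw [Finset.mul_sum]
    refine Finset.sum_le_sum fun i _ => ?_
    rw [hD, ← mul_pow]
    gcongr
    exact hl _ _ _
  have h4 := sum_inner_mix_step_le hr hl hL.le hα.le hβ x y
  have h5 := neg_sum_inner_mix_step_le h0 hr hc hl hL.le hα.le x y N
  simp only [← hx', ← hu, ← hD] at h4 h5
  have h6 := sum_norm_sq_mix_sub_rowMean_le hn hr y
  simp only [← hu] at h6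
  have h7 := mul_norm_sq_rowMean_apply_le hn hl hxs x
  have h8 : n * ‖rowMean y‖ ^ 2 = n * ‖rowMean (fun i => h i (x i))‖ ^ 2 +
      (2 * (n * inner ℝ (rowMean (fun i => h i (x i))) (rowMean N)) + n * ‖rowMean N‖ ^ 2) := by
    rw [hy, norm_add_sq_real]; ring
  -- `αL/2` comes from the inner product and `α²L²` from the squared step length; `αL ≤ 1/2` merges
  -- them.
  have h9 : (α * L / 2 + α ^ 2 * L ^ 2) * (n * ‖rowMean y‖ ^ 2) ≤
      α * L * (n * ‖rowMean y‖ ^ 2) := by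
    gcongr
    have : α * L * (α * L) ≤ α * L * (1 / 2) := by gcongr
    nlinarith
  have h10 : α * L * (n * ‖rowMean (fun i => h i (x i))‖ ^ 2) ≤
      α * L * (2 * L ^ 2 * consensusSq x + 2 * n * L ^ 2 * ‖rowMean x - xs‖ ^ 2) := by gcongr
  have h11 : (1 + 4 * α * L + 2 * α ^ 2 * L ^ 2 + β) * ∑ i, ‖u i‖ ^ 2 ≤
      (1 + 4 * α * L + 2 * α ^ 2 * L ^ 2 + β) * (rhoW W ^ 2 * consensusSq y) := by gcongr
  -- Slack: the estimates give `2αL³`, while the matrix has `3αL³`.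
  have h12 : 0 ≤ α * L ^ 3 * consensusSq x := by
    unfold consensusSq; positivity
  have h13 : 0 ≤ n * ‖rowMean (fun i => D i - N i + N' i)‖ ^ 2 := by positivity
  rw [h2] at h1
  have h14 := congrArg (α * L * ·) h8
  simp only [mul_add (α * L)] at h14
  linarith

end Pathwise

/-! ### Noise at a random point independent of the sample -/

section Freezing

variable {Ω : Type*} [MeasurableSpace Ω] {P : Measure Ω} [IsProbabilityMeasure P] {p m : ℕ}

omit [IsProbabilityMeasure P] in
theorem integrable_inner_of_memLp {u v : Ω → EuclideanSpace ℝ (Fin p)} (hu : MemLp u 2 P)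
    (hv : MemLp v 2 P) : Integrable (fun ω => inner ℝ (u ω) (v ω)) P := by
  refine ((hu.integrable_norm_pow (p := 2) (by norm_num)).add
    (hv.integrable_norm_pow (p := 2) (by norm_num))).mono' (hu.1.inner hv.1)
    (Eventually.of_forall fun ω => ?_)
  refine (norm_inner_le_norm _ _).trans ?_
  simp only [Pi.add_apply]
  nlinarith [sq_nonneg (‖u ω‖ - ‖v ω‖), sq_nonneg (‖u ω‖), sq_nonneg (‖v ω‖)]

/-- A stochastic gradient at a random point that is independent of the sample is square
integrable around the gradient. -/
theorem memLp_noise {G : EuclideanSpace ℝ (Fin p) → EuclideanSpace ℝ (Fin m) →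
    EuclideanSpace ℝ (Fin p)} (hG : Measurable fun z : EuclideanSpace ℝ (Fin p) ×
      EuclideanSpace ℝ (Fin m) => G z.1 z.2)
    {h : EuclideanSpace ℝ (Fin p) → EuclideanSpace ℝ (Fin p)} (hh : Measurable h)
    {X : Ω → EuclideanSpace ℝ (Fin p)} (hX : Measurable X)
    {ζ : Ω → EuclideanSpace ℝ (Fin m)} (hζ : Measurable ζ) (hind : IndepFun X ζ P)
    (hmem : ∀ x, MemLp (fun ω => G x (ζ ω)) 2 P) {σ : ℝ}
    (hvar : ∀ x, ∫ ω, ‖G x (ζ ω) - h x‖ ^ 2 ∂P ≤ σ ^ 2) :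
    MemLp (fun ω => G (X ω) (ζ ω) - h (X ω)) 2 P ∧
      ∫ ω, ‖G (X ω) (ζ ω) - h (X ω)‖ ^ 2 ∂P ≤ σ ^ 2 := by
  have hmeas : Measurable fun z : EuclideanSpace ℝ (Fin p) × EuclideanSpace ℝ (Fin m) =>
      G z.1 z.2 - h z.1 := hG.sub (hh.comp measurable_fst)
  have hm2 : Measurable fun z : EuclideanSpace ℝ (Fin p) × EuclideanSpace ℝ (Fin m) =>
      ENNReal.ofReal (‖G z.1 z.2 - h z.1‖ ^ 2) := (hmeas.norm.pow_const 2).ennreal_ofReal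
  have hcomp : Measurable fun ω => G (X ω) (ζ ω) - h (X ω) := hmeas.comp (hX.prodMk hζ)
  have hle : ∫⁻ ω, ENNReal.ofReal (‖G (X ω) (ζ ω) - h (X ω)‖ ^ 2) ∂P ≤
      ENNReal.ofReal (σ ^ 2) := by
    -- Integrability is part of the claim, so Tonelli's theorem is used: under the product law the
    -- point is frozen and the variance bound at fixed points applies.
    have e : ∫⁻ ω, ENNReal.ofReal (‖G (X ω) (ζ ω) - h (X ω)‖ ^ 2) ∂P =
        ∫⁻ z, ENNReal.ofReal (‖G z.1 z.2 - h z.1‖ ^ 2) ∂(P.map fun ω => (X ω, ζ ω)) := by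
      rw [lintegral_map hm2 (hX.prodMk hζ)]
    have : IsProbabilityMeasure (P.map ζ) := Measure.isProbabilityMeasure_map hζ.aemeasurable
    have : IsProbabilityMeasure (P.map X) := Measure.isProbabilityMeasure_map hX.aemeasurable
    have hinner : ∀ x, ∫⁻ v, ENNReal.ofReal (‖G x v - h x‖ ^ 2) ∂(P.map ζ) ≤
        ENNReal.ofReal (σ ^ 2) := by
      intro x
      have hx : MemLp (fun ω => G x (ζ ω) - h x) 2 P := (hmem x).sub (memLp_const (h x))
      have hx2 : Integrable (fun ω => ‖G x (ζ ω) - h x‖ ^ 2) P :=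
        (memLp_two_iff_integrable_sq_norm hx.1).1 hx
      have hx3 : Measurable fun v => ENNReal.ofReal (‖G x v - h x‖ ^ 2) :=
        ((hG.of_uncurry_left.sub_const (h x)).norm.pow_const 2).ennreal_ofReal
      rw [lintegral_map hx3 hζ, ← ofReal_integral_eq_lintegral_ofReal hx2
        (Eventually.of_forall fun ω => sq_nonneg (‖G x (ζ ω) - h x‖))]
      exact ENNReal.ofReal_le_ofReal (hvar x)
    rw [e, (indepFun_iff_map_prod_eq_prod_map_map hX.aemeasurable hζ.aemeasurable).1 hind,
      lintegral_prod _ hm2.aemeasurable]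
    refine (lintegral_mono hinner).trans_eq ?_
    rw [lintegral_const, measure_univ, mul_one]
  have hint : Integrable (fun ω => ‖G (X ω) (ζ ω) - h (X ω)‖ ^ 2) P := by
    refine ⟨(hcomp.norm.pow_const 2).aestronglyMeasurable, ?_⟩
    rw [hasFiniteIntegral_iff_ofReal (Eventually.of_forall fun _ => by positivity)]
    exact hle.trans_lt ENNReal.ofReal_lt_top
  refine ⟨(memLp_two_iff_integrable_sq_norm hcomp.aestronglyMeasurable).2 hint, ?_⟩
  rw [← ENNReal.ofReal_le_ofReal_iff (sq_nonneg σ), ofReal_integral_eq_lintegral_ofReal hint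
    (Eventually.of_forall fun _ => by positivity)]
  exact hle

/-- The noise of a stochastic gradient is orthogonal to what is independent of the sample. -/
theorem integral_inner_noise_eq_zero {G : EuclideanSpace ℝ (Fin p) → EuclideanSpace ℝ (Fin m) →
    EuclideanSpace ℝ (Fin p)} (hG : Measurable fun z : EuclideanSpace ℝ (Fin p) ×
      EuclideanSpace ℝ (Fin m) => G z.1 z.2)
    {h : EuclideanSpace ℝ (Fin p) → EuclideanSpace ℝ (Fin p)} (hh : Measurable h)
    {X Z : Ω → EuclideanSpace ℝ (Fin p)} (hX : Measurable X) (hZ : Measurable Z)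
    {ζ : Ω → EuclideanSpace ℝ (Fin m)} (hζ : Measurable ζ)
    (hind : IndepFun (fun ω => (X ω, Z ω)) ζ P)
    (hmem : ∀ x, MemLp (fun ω => G x (ζ ω)) 2 P) (hunb : ∀ x, ∫ ω, G x (ζ ω) ∂P = h x)
    (hZ2 : MemLp Z 2 P) (hN2 : MemLp (fun ω => G (X ω) (ζ ω) - h (X ω)) 2 P) :
    ∫ ω, inner ℝ (Z ω) (G (X ω) (ζ ω) - h (X ω)) ∂P = 0 := by
  have hXZ := hX.prodMk hZ
  let Φ : (EuclideanSpace ℝ (Fin p) × EuclideanSpace ℝ (Fin p)) × EuclideanSpace ℝ (Fin m) → ℝ :=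
    fun z => inner ℝ z.1.2 (G z.1.1 z.2 - h z.1.1)
  have hΦ : Measurable Φ := by
    refine Measurable.inner (measurable_snd.comp measurable_fst) (Measurable.sub ?_ ?_)
    · exact hG.comp ((measurable_fst.comp measurable_fst).prodMk measurable_snd)
    · exact hh.comp (measurable_fst.comp measurable_fst)
  -- Independence gives a product law, so the sample can be integrated first with `X` and `Z`
  -- frozen; unbiasedness makes that inner integral zero.
  have hmap := (indepFun_iff_map_prod_eq_prod_map_map hXZ.aemeasurable hζ.aemeasurable).1 hind
  have hint : Integrable Φ ((P.map fun ω => (X ω, Z ω)).prod (P.map ζ)) := by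
    rw [← hmap, integrable_map_measure hΦ.aestronglyMeasurable (hXZ.prodMk hζ).aemeasurable]
    exact integrable_inner_of_memLp hZ2 hN2
  have : IsProbabilityMeasure (P.map fun ω => (X ω, Z ω)) :=
    Measure.isProbabilityMeasure_map hXZ.aemeasurable
  have : IsProbabilityMeasure (P.map ζ) := Measure.isProbabilityMeasure_map hζ.aemeasurable
  have e : ∫ ω, inner ℝ (Z ω) (G (X ω) (ζ ω) - h (X ω)) ∂P =
      ∫ z, Φ z ∂(P.map fun ω => ((X ω, Z ω), ζ ω)) := by
    rw [integral_map (hXZ.prodMk hζ).aemeasurable hΦ.aestronglyMeasurable]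
  rw [e, hmap, integral_prod _ hint]
  refine integral_eq_zero_of_ae (Eventually.of_forall fun z => ?_)
  change ∫ v, Φ (z, v) ∂(P.map ζ) = 0
  rw [integral_map (f := fun v => Φ (z, v)) hζ.aemeasurable
    (hΦ.comp measurable_prodMk_left).aestronglyMeasurable]
  have hi := (hmem z.1).integrable one_le_two
  change ∫ ω, inner ℝ z.2 (G z.1 (ζ ω) - h z.1) ∂P = 0
  have hi2 : Integrable (fun ω => G z.1 (ζ ω) - h z.1) P := hi.sub (integrable_const _)
  rw [integral_inner hi2, integral_sub hi (integrable_const _), hunb]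
  simp

end Freezing

/-! ### Measurability, independence and square integrability of the iterates -/

section Iterates

variable {Ω : Type*} {n p m : ℕ}

/-- The σ-algebra generated by the samples with index in `S`. -/
@[reducible]
def sampleSigma (ξ : ℕ → Fin n → Ω → EuclideanSpace ℝ (Fin m)) (S : Set (ℕ × Fin n)) :
    MeasurableSpace Ω :=
  ⨆ q ∈ S, MeasurableSpace.comap (ξ q.1 q.2) inferInstance

theorem sampleSigma_mono (ξ : ℕ → Fin n → Ω → EuclideanSpace ℝ (Fin m)) {S T : Set (ℕ × Fin n)}
    (h : S ⊆ T) : sampleSigma ξ S ≤ sampleSigma ξ T :=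
  biSup_mono h

theorem measurable_sampleSigma (ξ : ℕ → Fin n → Ω → EuclideanSpace ℝ (Fin m))
    {S : Set (ℕ × Fin n)} {k : ℕ} {i : Fin n} (h : (k, i) ∈ S) :
    Measurable[sampleSigma ξ S] (ξ k i) := by
  have h1 : MeasurableSpace.comap (ξ k i) inferInstance ≤ sampleSigma ξ S :=
    le_biSup (fun q : ℕ × Fin n => MeasurableSpace.comap (ξ q.1 q.2) inferInstance) h
  exact (comap_measurable (ξ k i)).mono h1 le_rfl

/-- The estimates `x k` of the solution. -/
noncomputable def iterX (W : Matrix (Fin n) (Fin n) ℝ) (α : ℝ)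
    (g : Fin n → EuclideanSpace ℝ (Fin p) → EuclideanSpace ℝ (Fin m) → EuclideanSpace ℝ (Fin p))
    (x0 : Fin n → EuclideanSpace ℝ (Fin p)) (ξ : ℕ → Fin n → Ω → EuclideanSpace ℝ (Fin m))
    (k : ℕ) (ω : Ω) : Fin n → EuclideanSpace ℝ (Fin p) :=
  (dsgt W α g x0 (fun j i => ξ j i ω) k).1

/-- The trackers `y k` of the average gradient. -/
noncomputable def iterY (W : Matrix (Fin n) (Fin n) ℝ) (α : ℝ)
    (g : Fin n → EuclideanSpace ℝ (Fin p) → EuclideanSpace ℝ (Fin m) → EuclideanSpace ℝ (Fin p))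
    (x0 : Fin n → EuclideanSpace ℝ (Fin p)) (ξ : ℕ → Fin n → Ω → EuclideanSpace ℝ (Fin m))
    (k : ℕ) (ω : Ω) : Fin n → EuclideanSpace ℝ (Fin p) :=
  (dsgt W α g x0 (fun j i => ξ j i ω) k).2

/-- The noise of the stochastic gradients at the iterates. -/
noncomputable def gradNoise (W : Matrix (Fin n) (Fin n) ℝ) (α : ℝ)
    (f : Fin n → EuclideanSpace ℝ (Fin p) → ℝ)
    (g : Fin n → EuclideanSpace ℝ (Fin p) → EuclideanSpace ℝ (Fin m) → EuclideanSpace ℝ (Fin p))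
    (x0 : Fin n → EuclideanSpace ℝ (Fin p)) (ξ : ℕ → Fin n → Ω → EuclideanSpace ℝ (Fin m))
    (k : ℕ) (ω : Ω) (i : Fin n) : EuclideanSpace ℝ (Fin p) :=
  g i (iterX W α g x0 ξ k ω i) (ξ k i ω) - gradient (f i) (iterX W α g x0 ξ k ω i)

variable {W : Matrix (Fin n) (Fin n) ℝ} {α : ℝ} {f : Fin n → EuclideanSpace ℝ (Fin p) → ℝ}
  {g : Fin n → EuclideanSpace ℝ (Fin p) → EuclideanSpace ℝ (Fin m) → EuclideanSpace ℝ (Fin p)}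
  {x0 : Fin n → EuclideanSpace ℝ (Fin p)} {ξ : ℕ → Fin n → Ω → EuclideanSpace ℝ (Fin m)}

theorem iterX_zero (ω : Ω) : iterX W α g x0 ξ 0 ω = x0 := rfl

theorem iterY_zero (ω : Ω) (i : Fin n) : iterY W α g x0 ξ 0 ω i = g i (x0 i) (ξ 0 i ω) := rfl

theorem iterX_succ (k : ℕ) (ω : Ω) (i : Fin n) : iterX W α g x0 ξ (k + 1) ω i =
    ∑ j, W i j • (iterX W α g x0 ξ k ω j - α • iterY W α g x0 ξ k ω j) := rfl

theorem iterY_succ (k : ℕ) (ω : Ω) (i : Fin n) : iterY W α g x0 ξ (k + 1) ω i =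
    ∑ j, W i j • iterY W α g x0 ξ k ω j + g i (iterX W α g x0 ξ (k + 1) ω i) (ξ (k + 1) i ω)
      - g i (iterX W α g x0 ξ k ω i) (ξ k i ω) := rfl

theorem oracle_eq (k : ℕ) (ω : Ω) (i : Fin n) : g i (iterX W α g x0 ξ k ω i) (ξ k i ω) =
    gradient (f i) (iterX W α g x0 ξ k ω i) + gradNoise W α f g x0 ξ k ω i := by
  simp [gradNoise]

/-- The average tracker is the average stochastic gradient. -/
theorem rowMean_iterY (hc : ∀ j, ∑ i, W i j = 1) (k : ℕ) (ω : Ω) :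
    rowMean (iterY W α g x0 ξ k ω) =
      rowMean (fun i => gradient (f i) (iterX W α g x0 ξ k ω i)) +
        rowMean (gradNoise W α f g x0 ξ k ω) := by
  rw [← rowMean_add]
  simp only [← oracle_eq]
  induction k with
  | zero => rfl
  | succ k ih =>
    rw [show iterY W α g x0 ξ (k + 1) ω = _ from funext fun i => iterY_succ k ω i]
    rw [rowMean_sub (fun i => ∑ j, W i j • iterY W α g x0 ξ k ω j +
      g i (iterX W α g x0 ξ (k + 1) ω i) (ξ (k + 1) i ω)), rowMean_add, rowMean_mix hc, ih]
    abel

theorem rowMean_iterX_succ (hc : ∀ j, ∑ i, W i j = 1) (k : ℕ) (ω : Ω) :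
    rowMean (iterX W α g x0 ξ (k + 1) ω) = rowMean (iterX W α g x0 ξ k ω) -
      α • (rowMean (fun i => gradient (f i) (iterX W α g x0 ξ k ω i)) +
        rowMean (gradNoise W α f g x0 ξ k ω)) := by
  rw [show iterX W α g x0 ξ (k + 1) ω = _ from funext fun i => iterX_succ k ω i,
    rowMean_mix hc, rowMean_sub, rowMean_smul, rowMean_iterY (f := f) hc]

theorem IsStronglyConvexSmooth.continuous_gradient {φ : EuclideanSpace ℝ (Fin p) → ℝ} {μ L : ℝ}
    (hφ : IsStronglyConvexSmooth φ μ L) : Continuous (gradient φ) :=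
  (LipschitzWith.of_dist_le' fun x y => by
    simpa only [dist_eq_norm] using hφ.lipschitz x y).continuous

theorem measurable_oracle_of (hG : ∀ i, Measurable (fun z : EuclideanSpace ℝ (Fin p) ×
      EuclideanSpace ℝ (Fin m) => g i z.1 z.2)) {S : Set (ℕ × Fin n)} {k : ℕ} {i : Fin n}
    (hS : (k, i) ∈ S) (hx : Measurable[sampleSigma ξ S] fun ω => iterX W α g x0 ξ k ω i) :
    Measurable[sampleSigma ξ S] fun ω => g i (iterX W α g x0 ξ k ω i) (ξ k i ω) :=
  (hG i).comp (hx.prodMk (measurable_sampleSigma ξ hS))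

theorem measurable_mix {m' : MeasurableSpace Ω} {z : Ω → Fin n → EuclideanSpace ℝ (Fin p)}
    (hz : ∀ i, Measurable[m'] fun ω => z ω i) (W : Matrix (Fin n) (Fin n) ℝ) (i : Fin n) :
    Measurable[m'] fun ω => ∑ j, W i j • z ω j :=
  Finset.measurable_sum _ fun j _ => (hz j).const_smul (W i j)

/-- The iterates only depend on the samples of the past, and so do the trackers but for the
current noise. -/
theorem measurable_iter (hG : ∀ i, Measurable (fun z : EuclideanSpace ℝ (Fin p) ×
      EuclideanSpace ℝ (Fin m) => g i z.1 z.2)) (hh : ∀ i, Measurable (gradient (f i))) (k : ℕ) :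
    (∀ i, Measurable[sampleSigma ξ {q | q.1 < k}] fun ω => iterX W α g x0 ξ k ω i) ∧
    (∀ i, Measurable[sampleSigma ξ {q | q.1 < k}] fun ω => iterY W α g x0 ξ k ω i -
      gradNoise W α f g x0 ξ k ω i) := by
  induction k with
  | zero =>
    refine ⟨fun i => by simpa only [iterX_zero] using measurable_const, fun i => ?_⟩
    simp only [iterY_zero, gradNoise, iterX_zero, sub_sub_cancel]
    exact measurable_const
  | succ k ih =>
    have hle : sampleSigma ξ {q : ℕ × Fin n | q.1 < k} ≤
        sampleSigma ξ {q : ℕ × Fin n | q.1 < k + 1} :=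
      sampleSigma_mono ξ fun q (hq : q.1 < k) => Nat.lt_succ_of_lt hq
    have hx : ∀ i, Measurable[sampleSigma ξ {q : ℕ × Fin n | q.1 < k + 1}]
        fun ω => iterX W α g x0 ξ k ω i := fun i => (ih.1 i).mono hle le_rfl
    have hg : ∀ i, Measurable[sampleSigma ξ {q : ℕ × Fin n | q.1 < k + 1}]
        fun ω => g i (iterX W α g x0 ξ k ω i) (ξ k i ω) := fun i =>
      measurable_oracle_of hG (Nat.lt_succ_self k) (hx i)
    have hy : ∀ i, Measurable[sampleSigma ξ {q : ℕ × Fin n | q.1 < k + 1}]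
        fun ω => iterY W α g x0 ξ k ω i := by
      intro i
      have h1 := ((ih.2 i).mono hle le_rfl).add ((hg i).sub ((hh i).comp (hx i)))
      convert h1 using 1
      funext ω
      simp [gradNoise]
    have hx' : ∀ i, Measurable[sampleSigma ξ {q : ℕ × Fin n | q.1 < k + 1}]
        fun ω => iterX W α g x0 ξ (k + 1) ω i := by
      intro i
      simp only [iterX_succ]
      exact measurable_mix (z := fun ω j => iterX W α g x0 ξ k ω j - α • iterY W α g x0 ξ k ω j)
        (fun j => (hx j).sub ((hy j).const_smul α)) W i
    refine ⟨hx', fun i => ?_⟩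
    -- Removing the noise replaces the fresh sampled gradient by the true one at `x (k + 1)`, so
    -- only samples up to time `k` remain.
    have h1 := ((measurable_mix (z := fun ω j => iterY W α g x0 ξ k ω j) hy W i).sub (hg i)).add
      ((hh i).comp (hx' i))
    convert h1 using 1
    funext ω
    simp only [iterY_succ, gradNoise, Pi.add_apply, Pi.sub_apply, Function.comp_apply]
    abel

variable [MeasurableSpace Ω] {P : Measure Ω} {μ L σ : ℝ}

theorem sampleSigma_le (hg : IsGradientOracle P f g ξ σ) (S : Set (ℕ × Fin n)) :
    sampleSigma ξ S ≤ ‹MeasurableSpace Ω› :=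
  iSup₂_le fun q _ => (hg.measurable_sample q.1 q.2).comap_le

/-- What depends on the other samples only is independent of a sample. -/
theorem indepFun_sample (hg : IsGradientOracle P f g ξ σ) {k : ℕ} {i : Fin n} {β : Type*}
    [MeasurableSpace β] {Z : Ω → β} (hZ : Measurable[sampleSigma ξ {q | q ≠ (k, i)}] Z) :
    IndepFun Z (ξ k i) P := by
  have h1 := indep_iSup_of_disjoint (fun q : ℕ × Fin n => (hg.measurable_sample q.1 q.2).comap_le)
    hg.indep (S := {q | q ≠ (k, i)}) (T := {(k, i)}) (by simp)
  rw [IndepFun_iff_Indep]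
  refine indep_of_indep_of_le_left (indep_of_indep_of_le_right h1 ?_) hZ.comap_le
  simp

/-- The σ-algebra of all samples but one, rather than that of the past, also accommodates the noises
of the other agents at the same time. -/
theorem measurable_iterX_other (hg : IsGradientOracle P f g ξ σ)
    (hf : ∀ i, IsStronglyConvexSmooth (f i) μ L) (k : ℕ) (i j : Fin n) :
    Measurable[sampleSigma ξ {q | q ≠ (k, i)}] fun ω => iterX W α g x0 ξ k ω j :=
  ((measurable_iter hg.measurable_oracle (fun i => (hf i).continuous_gradient.measurable) k).1 j).mono
    (sampleSigma_mono ξ fun q (hq : q.1 < k) h => by simp [h] at hq) le_rfl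

theorem measurable_iterX (hg : IsGradientOracle P f g ξ σ)
    (hf : ∀ i, IsStronglyConvexSmooth (f i) μ L) (k : ℕ) (i : Fin n) :
    Measurable fun ω => iterX W α g x0 ξ k ω i :=
  ((measurable_iter hg.measurable_oracle (fun i => (hf i).continuous_gradient.measurable) k).1 i).mono
    (sampleSigma_le hg _) le_rfl

theorem MemLp.mix {z : Ω → Fin n → EuclideanSpace ℝ (Fin p)}
    (hz : ∀ i, MemLp (fun ω => z ω i) 2 P) (W : Matrix (Fin n) (Fin n) ℝ) (i : Fin n) :
    MemLp (fun ω => ∑ j, W i j • z ω j) 2 P :=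
  memLp_finsetSum _ fun j _ => (hz j).const_smul (W i j)

theorem MemLp.rowMean {z : Ω → Fin n → EuclideanSpace ℝ (Fin p)}
    (hz : ∀ i, MemLp (fun ω => z ω i) 2 P) : MemLp (fun ω => rowMean (z ω)) 2 P :=
  (memLp_finsetSum _ fun j _ => hz j).const_smul (1 / (n : ℝ))

variable [IsProbabilityMeasure P]

/-- The iterate at time `k` is independent of the sample drawn there, so the variance bound at fixed
points carries over. -/
theorem memLp_gradNoise (hg : IsGradientOracle P f g ξ σ)
    (hf : ∀ i, IsStronglyConvexSmooth (f i) μ L) (k : ℕ) (i : Fin n) :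
    MemLp (fun ω => gradNoise W α f g x0 ξ k ω i) 2 P ∧
      ∫ ω, ‖gradNoise W α f g x0 ξ k ω i‖ ^ 2 ∂P ≤ σ ^ 2 :=
  memLp_noise (hg.measurable_oracle i) (hf i).continuous_gradient.measurable
    (measurable_iterX hg hf k i) (hg.measurable_sample k i)
    (indepFun_sample hg (measurable_iterX_other hg hf k i i)) (hg.memLp k i) (hg.variance_le k i)

/-- The noise of agent `i` is orthogonal to what depends on the other samples only. -/
theorem integral_inner_gradNoise_eq_zero (hg : IsGradientOracle P f g ξ σ)
    (hf : ∀ i, IsStronglyConvexSmooth (f i) μ L) {k : ℕ} {i : Fin n}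
    {Z : Ω → EuclideanSpace ℝ (Fin p)} (hZ : Measurable[sampleSigma ξ {q | q ≠ (k, i)}] Z)
    (hZ2 : MemLp Z 2 P) : ∫ ω, inner ℝ (Z ω) (gradNoise W α f g x0 ξ k ω i) ∂P = 0 :=
  integral_inner_noise_eq_zero (hg.measurable_oracle i) (hf i).continuous_gradient.measurable
    (measurable_iterX hg hf k i) (hZ.mono (sampleSigma_le hg _) le_rfl) (hg.measurable_sample k i)
    (indepFun_sample hg ((measurable_iterX_other hg hf k i i).prodMk hZ)) (hg.memLp k i)
    (hg.unbiased k i) hZ2 (memLp_gradNoise hg hf k i).1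

theorem integral_inner_gradNoise_eq_zero_of_past (hg : IsGradientOracle P f g ξ σ)
    (hf : ∀ i, IsStronglyConvexSmooth (f i) μ L) {k : ℕ} {i : Fin n}
    {Z : Ω → EuclideanSpace ℝ (Fin p)} (hZ : Measurable[sampleSigma ξ {q | q.1 < k}] Z)
    (hZ2 : MemLp Z 2 P) : ∫ ω, inner ℝ (Z ω) (gradNoise W α f g x0 ξ k ω i) ∂P = 0 :=
  integral_inner_gradNoise_eq_zero hg hf (hZ.mono
    (sampleSigma_mono ξ fun q (hq : q.1 < k) h => by simp [h] at hq) le_rfl) hZ2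

/-- The noises of different agents are uncorrelated. -/
theorem integral_inner_gradNoise_gradNoise (hg : IsGradientOracle P f g ξ σ)
    (hf : ∀ i, IsStronglyConvexSmooth (f i) μ L) (k : ℕ) {i j : Fin n} (hij : j ≠ i) :
    ∫ ω, inner ℝ (gradNoise W α f g x0 ξ k ω j) (gradNoise W α f g x0 ξ k ω i) ∂P = 0 := by
  -- The noise of agent `j` involves its own sample and earlier ones, never the sample `(k, i)`.
  refine integral_inner_gradNoise_eq_zero hg hf ?_ (memLp_gradNoise hg hf k j).1
  have hx := measurable_iterX_other (W := W) (α := α) (x0 := x0) hg hf k i j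
  exact (measurable_oracle_of hg.measurable_oracle (by simp [hij]) hx).sub
    ((hf j).continuous_gradient.measurable.comp hx)

theorem MemLp.gradient_comp {φ : EuclideanSpace ℝ (Fin p) → ℝ}
    (hφ : IsStronglyConvexSmooth φ μ L) {X : Ω → EuclideanSpace ℝ (Fin p)} (hX : MemLp X 2 P) :
    MemLp (fun ω => gradient φ (X ω)) 2 P := by
  have h1 : MemLp (fun ω => gradient φ (X ω) - gradient φ 0) 2 P := by
    refine hX.of_le_mul (c := L) ((hφ.continuous_gradient.comp_aestronglyMeasurable hX.1).sub
      aestronglyMeasurable_const) (Eventually.of_forall fun ω => ?_)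
    simpa using hφ.lipschitz (X ω) 0
  have h2 := h1.add (memLp_const (gradient φ 0))
  simp only [Pi.add_def, sub_add_cancel] at h2
  exact h2

/-- The iterates and the trackers are square integrable. -/
theorem memLp_iter (hg : IsGradientOracle P f g ξ σ)
    (hf : ∀ i, IsStronglyConvexSmooth (f i) μ L) (k : ℕ) :
    (∀ i, MemLp (fun ω => iterX W α g x0 ξ k ω i) 2 P) ∧
    (∀ i, MemLp (fun ω => iterY W α g x0 ξ k ω i) 2 P) := by
  induction k with
  | zero => exact ⟨fun i => memLp_const _, fun i => hg.memLp 0 i (x0 i)⟩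
  | succ k ih =>
    have hgk : ∀ k, (∀ i, MemLp (fun ω => iterX W α g x0 ξ k ω i) 2 P) →
        ∀ i, MemLp (fun ω => g i (iterX W α g x0 ξ k ω i) (ξ k i ω)) 2 P := by
      intro k hk i
      simp only [oracle_eq (f := f)]
      exact (MemLp.gradient_comp (hf i) (hk i)).add (memLp_gradNoise hg hf k i).1
    have hx' : ∀ i, MemLp (fun ω => iterX W α g x0 ξ (k + 1) ω i) 2 P := by
      intro i
      simp only [iterX_succ]
      exact MemLp.mix (z := fun ω j => iterX W α g x0 ξ k ω j - α • iterY W α g x0 ξ k ω j)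
        (fun j => (ih.1 j).sub ((ih.2 j).const_smul α)) W i
    refine ⟨hx', fun i => ?_⟩
    simp only [iterY_succ]
    exact ((MemLp.mix ih.2 W i).add (hgk (k + 1) hx' i)).sub (hgk k ih.1 i)

end Iterates

/-! ### The three expected errors -/

section Recursion

variable {Ω : Type*} {n p m : ℕ} {W : Matrix (Fin n) (Fin n) ℝ} {α : ℝ}
  {f : Fin n → EuclideanSpace ℝ (Fin p) → ℝ}
  {g : Fin n → EuclideanSpace ℝ (Fin p) → EuclideanSpace ℝ (Fin m) → EuclideanSpace ℝ (Fin p)}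
  {x0 : Fin n → EuclideanSpace ℝ (Fin p)} {ξ : ℕ → Fin n → Ω → EuclideanSpace ℝ (Fin m)}

theorem measurable_rowMean {m' : MeasurableSpace Ω} {z : Ω → Fin n → EuclideanSpace ℝ (Fin p)}
    (hz : ∀ i, Measurable[m'] fun ω => z ω i) : Measurable[m'] fun ω => rowMean (z ω) :=
  (Finset.measurable_sum _ fun j _ => hz j).const_smul (1 / (n : ℝ))

variable [MeasurableSpace Ω] {P : Measure Ω} {μ L σ : ℝ}

theorem measurable_iterX_past (hg : IsGradientOracle P f g ξ σ)
    (hf : ∀ i, IsStronglyConvexSmooth (f i) μ L) {k l : ℕ} (hkl : k ≤ l) (i : Fin n) :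
    Measurable[sampleSigma ξ {q | q.1 < l}] fun ω => iterX W α g x0 ξ k ω i :=
  ((measurable_iter hg.measurable_oracle (fun i => (hf i).continuous_gradient.measurable) k).1 i).mono
    (sampleSigma_mono ξ fun _ (hq : _ < k) => hq.trans_le hkl) le_rfl

theorem measurable_gradNoise_past (hg : IsGradientOracle P f g ξ σ)
    (hf : ∀ i, IsStronglyConvexSmooth (f i) μ L) (k : ℕ) (i : Fin n) :
    Measurable[sampleSigma ξ {q | q.1 < k + 1}] fun ω => gradNoise W α f g x0 ξ k ω i :=
  (measurable_oracle_of hg.measurable_oracle (Nat.lt_succ_self k)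
    (measurable_iterX_past hg hf k.le_succ i)).sub
    ((hf i).continuous_gradient.measurable.comp (measurable_iterX_past hg hf k.le_succ i))

theorem measurable_iterY_sub_past (hg : IsGradientOracle P f g ξ σ)
    (hf : ∀ i, IsStronglyConvexSmooth (f i) μ L) (k : ℕ) (i : Fin n) :
    Measurable[sampleSigma ξ {q | q.1 < k}] fun ω =>
      iterY W α g x0 ξ k ω i - gradNoise W α f g x0 ξ k ω i :=
  (measurable_iter hg.measurable_oracle (fun i => (hf i).continuous_gradient.measurable) k).2 i

theorem measurable_iterY_past (hg : IsGradientOracle P f g ξ σ)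
    (hf : ∀ i, IsStronglyConvexSmooth (f i) μ L) (k : ℕ) (i : Fin n) :
    Measurable[sampleSigma ξ {q | q.1 < k + 1}] fun ω => iterY W α g x0 ξ k ω i := by
  have h1 := ((measurable_iterY_sub_past (W := W) (α := α) (x0 := x0) hg hf k i).mono
    (sampleSigma_mono ξ fun _ (hq : _ < k) => hq.trans_le k.le_succ) le_rfl).add
    (measurable_gradNoise_past (W := W) (α := α) (x0 := x0) hg hf k i)
  simpa only [Pi.add_def, sub_add_cancel] using h1

theorem integrable_norm_sq {z : Ω → EuclideanSpace ℝ (Fin p)} (hz : MemLp z 2 P) :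
    Integrable (fun ω => ‖z ω‖ ^ 2) P :=
  (memLp_two_iff_integrable_sq_norm hz.1).1 hz

theorem integrable_consensusSq {z : Ω → Fin n → EuclideanSpace ℝ (Fin p)}
    (hz : ∀ i, MemLp (fun ω => z ω i) 2 P) : Integrable (fun ω => consensusSq (z ω)) P :=
  integrable_finsetSum _ fun i _ => integrable_norm_sq ((hz i).sub (MemLp.rowMean hz))

theorem consensusError_succ_eq_zero (hn : 0 < n) (hr : ∀ i, ∑ j, W i j = 1)
    (hc : ∀ j, ∑ i, W i j = 1) (h0 : rhoW W = 0) (k : ℕ) :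
    consensusError P (iterX W α g x0 ξ) (k + 1) = 0 := by
  have : ∀ ω, consensusSq (iterX W α g x0 ξ (k + 1) ω) = 0 := fun ω =>
    consensusSq_mix_eq_zero hn hr hc h0 _
  simp [consensusError, this]

variable [IsProbabilityMeasure P]

theorem memLp_iterX (hg : IsGradientOracle P f g ξ σ)
    (hf : ∀ i, IsStronglyConvexSmooth (f i) μ L) (k : ℕ) (i : Fin n) :
    MemLp (fun ω => iterX W α g x0 ξ k ω i) 2 P := (memLp_iter hg hf k).1 i

theorem memLp_iterY (hg : IsGradientOracle P f g ξ σ)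
    (hf : ∀ i, IsStronglyConvexSmooth (f i) μ L) (k : ℕ) (i : Fin n) :
    MemLp (fun ω => iterY W α g x0 ξ k ω i) 2 P := (memLp_iter hg hf k).2 i

/-- Linear combinations of the noises of all agents, tested against the noise of one agent. -/
theorem integral_inner_sum_gradNoise (hg : IsGradientOracle P f g ξ σ)
    (hf : ∀ i, IsStronglyConvexSmooth (f i) μ L) (k : ℕ) (c : Fin n → ℝ) (i : Fin n) :
    ∫ ω, inner ℝ (∑ j, c j • gradNoise W α f g x0 ξ k ω j) (gradNoise W α f g x0 ξ k ω i) ∂P =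
      c i * ∫ ω, ‖gradNoise W α f g x0 ξ k ω i‖ ^ 2 ∂P := by
  simp only [sum_inner, real_inner_smul_left]
  rw [integral_finsetSum _ fun j _ => (integrable_inner_of_memLp (memLp_gradNoise hg hf k j).1
    (memLp_gradNoise hg hf k i).1).const_mul (c j), Finset.sum_eq_single i]
  · simp only [real_inner_self_eq_norm_sq, integral_const_mul]
  · intro j _ hj
    rw [integral_const_mul, integral_inner_gradNoise_gradNoise hg hf k hj, mul_zero]
  · simp

theorem integral_inner_rowMean_gradNoise (hg : IsGradientOracle P f g ξ σ)
    (hf : ∀ i, IsStronglyConvexSmooth (f i) μ L) (k : ℕ) (i : Fin n) :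
    ∫ ω, inner ℝ (rowMean (gradNoise W α f g x0 ξ k ω)) (gradNoise W α f g x0 ξ k ω i) ∂P =
      1 / n * ∫ ω, ‖gradNoise W α f g x0 ξ k ω i‖ ^ 2 ∂P := by
  simp only [rowMean, Finset.smul_sum]
  exact integral_inner_sum_gradNoise hg hf k (fun _ => 1 / (n : ℝ)) i

theorem integral_sum_norm_sq_gradNoise_le (hg : IsGradientOracle P f g ξ σ)
    (hf : ∀ i, IsStronglyConvexSmooth (f i) μ L) (k : ℕ) :
    ∫ ω, ∑ i, ‖gradNoise W α f g x0 ξ k ω i‖ ^ 2 ∂P ≤ n * σ ^ 2 := by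
  rw [integral_finsetSum _ fun i _ => integrable_norm_sq (memLp_gradNoise hg hf k i).1]
  refine (Finset.sum_le_sum fun i _ => (memLp_gradNoise hg hf k i).2).trans_eq ?_
  simp

/-- Averaging over the agents reduces the variance of the noise. -/
theorem integral_norm_sq_rowMean_gradNoise_le (hn : 0 < n) (hg : IsGradientOracle P f g ξ σ)
    (hf : ∀ i, IsStronglyConvexSmooth (f i) μ L) (k : ℕ) :
    ∫ ω, n * ‖rowMean (gradNoise W α f g x0 ξ k ω)‖ ^ 2 ∂P ≤ σ ^ 2 := by
  have hn' : (0 : ℝ) < n := by positivity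
  -- Written this way, each summand has expectation `1 / n` times the variance of one agent, the
  -- noises being uncorrelated.
  have e : ∀ ω, n * ‖rowMean (gradNoise W α f g x0 ξ k ω)‖ ^ 2 =
      ∑ i, inner ℝ (rowMean (gradNoise W α f g x0 ξ k ω)) (gradNoise W α f g x0 ξ k ω i) := by
    intro ω
    rw [← inner_sum, ← smul_rowMean hn, inner_smul_right, real_inner_self_eq_norm_sq]
  simp only [e]
  rw [integral_finsetSum _ fun i _ => integrable_inner_of_memLp
    (MemLp.rowMean fun j => (memLp_gradNoise hg hf k j).1) (memLp_gradNoise hg hf k i).1]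
  simp only [integral_inner_rowMean_gradNoise hg hf]
  calc _ ≤ ∑ i : Fin n, 1 / (n : ℝ) * σ ^ 2 := by
        gcongr with i
        exact (memLp_gradNoise hg hf k i).2
    _ = _ := by simp; field_simp

theorem integral_inner_rowMean_gradNoise_of_past (hg : IsGradientOracle P f g ξ σ)
    (hf : ∀ i, IsStronglyConvexSmooth (f i) μ L) {k : ℕ}
    {Z : Ω → EuclideanSpace ℝ (Fin p)} (hZ : Measurable[sampleSigma ξ {q | q.1 < k}] Z)
    (hZ2 : MemLp Z 2 P) :
    ∫ ω, inner ℝ (Z ω) (rowMean (gradNoise W α f g x0 ξ k ω)) ∂P = 0 := by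
  simp only [rowMean, inner_smul_right, inner_sum]
  rw [integral_const_mul, integral_finsetSum _ fun i _ =>
    integrable_inner_of_memLp hZ2 (memLp_gradNoise hg hf k i).1]
  simp [integral_inner_gradNoise_eq_zero_of_past hg hf hZ hZ2]

/-- Recursion for the optimality error. -/
theorem optimalityError_succ_le (hn : 0 < n) (hc : ∀ j, ∑ i, W i j = 1)
    (hg : IsGradientOracle P f g ξ σ)
    (hf : ∀ i, IsStronglyConvexSmooth (f i) μ L) (hμ : 0 < μ) (hL : 0 < L)
    (hα : 0 < α) (hαL : α * L ≤ 1 / 2) (hαμ : α * μ ≤ 1 / 2) {xs : EuclideanSpace ℝ (Fin p)}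
    (hxs : rowMean (fun i => gradient (f i) xs) = 0) (k : ℕ) :
    optimalityError P (iterX W α g x0 ξ) xs (k + 1) ≤
      (1 - α * μ) * optimalityError P (iterX W α g x0 ξ) xs k +
      α * L ^ 2 / (μ * n) * (1 + α * μ) * consensusError P (iterX W α g x0 ξ) k +
      α ^ 2 * σ ^ 2 / n := by
  have hn' : (0 : ℝ) < n := by positivity
  have hX : ∀ k i, MemLp (fun ω => iterX W α g x0 ξ k ω i) 2 P := memLp_iterX hg hf
  have hNb : MemLp (fun ω => rowMean (gradNoise W α f g x0 ξ k ω)) 2 P :=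
    MemLp.rowMean fun j => (memLp_gradNoise hg hf k j).1
  have hZ2 : MemLp (fun ω => rowMean (iterX W α g x0 ξ k ω) -
      α • rowMean (fun i => gradient (f i) (iterX W α g x0 ξ k ω i)) - xs) 2 P :=
    ((MemLp.rowMean (hX k)).sub ((MemLp.rowMean (z := fun ω i => gradient (f i)
      (iterX W α g x0 ξ k ω i)) fun i => MemLp.gradient_comp (hf i) (hX k i)).const_smul α)).sub
      (memLp_const xs)
  have hZ : Measurable[sampleSigma ξ {q | q.1 < k}] (fun ω => rowMean (iterX W α g x0 ξ k ω) -
      α • rowMean (fun i => gradient (f i) (iterX W α g x0 ξ k ω i)) - xs) := by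
    have hx : ∀ i, Measurable[sampleSigma ξ {q | q.1 < k}] fun ω => iterX W α g x0 ξ k ω i :=
      measurable_iterX_past hg hf le_rfl
    exact ((measurable_rowMean hx).sub ((measurable_rowMean (z := fun ω i => gradient (f i)
      (iterX W α g x0 ξ k ω i)) fun i => (hf i).continuous_gradient.measurable.comp
      (hx i)).const_smul α)).sub_const xs
  have h0 := integral_inner_rowMean_gradNoise_of_past (W := W) (α := α) (x0 := x0) hg hf
    hZ hZ2
  have hi0 := integrable_norm_sq ((MemLp.rowMean (hX (k + 1))).sub (memLp_const xs))
  have hi1 := integrable_norm_sq ((MemLp.rowMean (hX k)).sub (memLp_const xs))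
  have hi2 := integrable_consensusSq (hX k)
  have hi3 := integrable_inner_of_memLp hZ2 hNb
  have hi4 := integrable_norm_sq hNb
  have h4 := integral_norm_sq_rowMean_gradNoise_le (W := W) (α := α) (x0 := x0) hn hg hf k
  rw [integral_const_mul] at h4
  have hstep := fun ω => optimality_step hn hf hμ hL hα hαL hαμ hxs (iterX W α g x0 ξ k ω)
    (rowMean (gradNoise W α f g x0 ξ k ω))
  simp only [← rowMean_iterX_succ hc] at hstep
  simp only [Pi.sub_apply] at hi0 hi1
  have h5 := integral_mono hi0 ((((hi1.const_mul (1 - α * μ)).add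
    (hi2.const_mul (α * L ^ 2 / (μ * n) * (1 + α * μ)))).sub (hi3.const_mul (2 * α))).add
    (hi4.const_mul (α ^ 2))) hstep
  rw [integral_add' (((hi1.const_mul _).add (hi2.const_mul _)).sub (hi3.const_mul _))
    (hi4.const_mul _), integral_sub' ((hi1.const_mul _).add (hi2.const_mul _)) (hi3.const_mul _),
    integral_add' (hi1.const_mul _) (hi2.const_mul _), integral_const_mul, integral_const_mul,
    integral_const_mul, integral_const_mul, h0] at h5
  have h6 : α ^ 2 * ∫ ω, ‖rowMean (gradNoise W α f g x0 ξ k ω)‖ ^ 2 ∂P ≤ α ^ 2 * σ ^ 2 / n := by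
    rw [le_div_iff₀ hn']
    have := mul_le_mul_of_nonneg_left h4 (sq_nonneg α)
    linarith
  simp only [optimalityError, consensusError]
  linarith

/-- Recursion for the consensus error. -/
theorem consensusError_succ_le (hn : 0 < n) (hr : ∀ i, ∑ j, W i j = 1)
    (hc : ∀ j, ∑ i, W i j = 1) (h0 : rhoW W ≠ 0) (h1 : rhoW W < 1)
    (hg : IsGradientOracle P f g ξ σ)
    (hf : ∀ i, IsStronglyConvexSmooth (f i) μ L) (k : ℕ) :
    consensusError P (iterX W α g x0 ξ) (k + 1) ≤
      (1 + rhoW W ^ 2) / 2 * consensusError P (iterX W α g x0 ξ) k +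
      α ^ 2 * ((1 + rhoW W ^ 2) * rhoW W ^ 2 / (1 - rhoW W ^ 2)) *
        consensusError P (iterY W α g x0 ξ) k := by
  have hi1 := integrable_consensusSq (memLp_iterX (W := W) (α := α) (x0 := x0) hg hf k)
  have hi2 := integrable_consensusSq (memLp_iterY (W := W) (α := α) (x0 := x0) hg hf k)
  have h2 := integral_mono
    (integrable_consensusSq (memLp_iterX (W := W) (α := α) (x0 := x0) hg hf (k + 1)))
    ((hi1.const_mul ((1 + rhoW W ^ 2) / 2)).add
      (hi2.const_mul (α ^ 2 * ((1 + rhoW W ^ 2) * rhoW W ^ 2 / (1 - rhoW W ^ 2)))))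
    fun ω => consensus_step hn hr hc h0 h1 (iterX W α g x0 ξ k ω) (iterY W α g x0 ξ k ω)
  rw [integral_add' (hi1.const_mul _) (hi2.const_mul _), integral_const_mul,
    integral_const_mul] at h2
  exact h2

/-- The mixed tracking error is almost uncorrelated with the noise. -/
theorem neg_sq_le_integral_inner_mix_gradNoise (hn : 0 < n) (hnn : ∀ i j, 0 ≤ W i j)
    (hg : IsGradientOracle P f g ξ σ)
    (hf : ∀ i, IsStronglyConvexSmooth (f i) μ L) (k : ℕ) :
    -σ ^ 2 ≤ ∫ ω, ∑ i, inner ℝ (∑ j, W i j • iterY W α g x0 ξ k ω j -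
      rowMean (iterY W α g x0 ξ k ω)) (gradNoise W α f g x0 ξ k ω i) ∂P := by
  have hn' : (0 : ℝ) < n := by positivity
  have hN : ∀ i, MemLp (fun ω => gradNoise W α f g x0 ξ k ω i) 2 P := fun i =>
    (memLp_gradNoise hg hf k i).1
  have hY : ∀ i, MemLp (fun ω => iterY W α g x0 ξ k ω i) 2 P := memLp_iterY hg hf k
  have hi : ∀ i, Integrable (fun ω => inner ℝ (∑ j, W i j • iterY W α g x0 ξ k ω j -
      rowMean (iterY W α g x0 ξ k ω)) (gradNoise W α f g x0 ξ k ω i)) P := fun i =>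
    integrable_inner_of_memLp ((MemLp.mix hY W i).sub (MemLp.rowMean hY)) (hN i)
  rw [integral_finsetSum _ fun i _ => hi i]
  have key : ∀ i, -(1 / n * σ ^ 2) ≤ ∫ ω, inner ℝ (∑ j, W i j • iterY W α g x0 ξ k ω j -
      rowMean (iterY W α g x0 ξ k ω)) (gradNoise W α f g x0 ξ k ω i) ∂P := by
    intro i
    have hYN : ∀ i, MemLp (fun ω => iterY W α g x0 ξ k ω i - gradNoise W α f g x0 ξ k ω i) 2 P :=
      fun i => (hY i).sub (hN i)
    have hm : ∀ i, Measurable[sampleSigma ξ {q | q.1 < k}] fun ω =>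
      iterY W α g x0 ξ k ω i - gradNoise W α f g x0 ξ k ω i := measurable_iterY_sub_past hg hf k
    have hZ2 := (MemLp.mix (z := fun ω j => iterY W α g x0 ξ k ω j - gradNoise W α f g x0 ξ k ω j)
      hYN W i).sub (MemLp.rowMean (z := fun ω j => iterY W α g x0 ξ k ω j -
        gradNoise W α f g x0 ξ k ω j) hYN)
    have hZ := (measurable_mix (z := fun ω j => iterY W α g x0 ξ k ω j -
      gradNoise W α f g x0 ξ k ω j) hm W i).sub (measurable_rowMean (z := fun ω j =>
        iterY W α g x0 ξ k ω j - gradNoise W α f g x0 ξ k ω j) hm)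
    have h0 := integral_inner_gradNoise_eq_zero_of_past (W := W) (α := α) (x0 := x0) (i := i)
      hg hf hZ hZ2
    have h1 := integral_inner_sum_gradNoise (W := W) (α := α) (x0 := x0) hg hf k (W i) i
    have h2 := integral_inner_rowMean_gradNoise (W := W) (α := α) (x0 := x0) hg hf k i
    -- The tracker is split into a part determined by the past, orthogonal to the noise, and the
    -- noise itself. What remains is `(W i i - 1/n) E‖N i‖²`, bounded below through `W i i ≥ 0`.
    have e : ∀ ω, inner ℝ (∑ j, W i j • iterY W α g x0 ξ k ω j -
        rowMean (iterY W α g x0 ξ k ω)) (gradNoise W α f g x0 ξ k ω i) =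
        inner ℝ (∑ j, W i j • (iterY W α g x0 ξ k ω j - gradNoise W α f g x0 ξ k ω j) -
          rowMean (fun j => iterY W α g x0 ξ k ω j - gradNoise W α f g x0 ξ k ω j))
          (gradNoise W α f g x0 ξ k ω i) +
        inner ℝ (∑ j, W i j • gradNoise W α f g x0 ξ k ω j) (gradNoise W α f g x0 ξ k ω i) -
        inner ℝ (rowMean (gradNoise W α f g x0 ξ k ω)) (gradNoise W α f g x0 ξ k ω i) := by
      intro ω
      rw [← inner_add_left, ← inner_sub_left, rowMean_sub]
      congr 1
      simp only [smul_sub, Finset.sum_sub_distrib]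
      abel
    have hi1 := integrable_inner_of_memLp hZ2 (hN i)
    have hi2 := integrable_inner_of_memLp (MemLp.mix hN W i) (hN i)
    have hi3 := integrable_inner_of_memLp (MemLp.rowMean hN) (hN i)
    simp only [e]
    have e2 := integral_sub' (hi1.add hi2) hi3
    rw [integral_add' hi1 hi2, h0, h1, h2] at e2
    refine le_of_le_of_eq ?_ e2.symm
    have h3 : 0 ≤ W i i * ∫ ω, ‖gradNoise W α f g x0 ξ k ω i‖ ^ 2 ∂P :=
      mul_nonneg (hnn i i) (integral_nonneg fun ω => sq_nonneg _)
    have h4 : 1 / (n : ℝ) * ∫ ω, ‖gradNoise W α f g x0 ξ k ω i‖ ^ 2 ∂P ≤ 1 / n * σ ^ 2 := by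
      gcongr
      exact (memLp_gradNoise hg hf k i).2
    linarith
  calc -σ ^ 2 = ∑ _i : Fin n, -(1 / (n : ℝ) * σ ^ 2) := by simp; field_simp
    _ ≤ _ := Finset.sum_le_sum fun i _ => key i

/-- Recursion for the tracking error. -/
theorem trackingError_succ_le (hn : 0 < n) (hnn : ∀ i j, 0 ≤ W i j) (hr : ∀ i, ∑ j, W i j = 1)
    (hc : ∀ j, ∑ i, W i j = 1) (hg : IsGradientOracle P f g ξ σ)
    (hf : ∀ i, IsStronglyConvexSmooth (f i) μ L) (hL : 0 < L)
    (hα : 0 < α) (hαL : α * L ≤ 1 / 2) {β : ℝ} (hβ : 0 < β) {xs : EuclideanSpace ℝ (Fin p)}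
    (hxs : rowMean (fun i => gradient (f i) xs) = 0) (k : ℕ) :
    consensusError P (iterY W α g x0 ξ) (k + 1) ≤
      2 * α * n * L ^ 3 * optimalityError P (iterX W α g x0 ξ) xs k +
      ((1 / β + 2) * distI W ^ 2 * L ^ 2 + 3 * α * L ^ 3) *
        consensusError P (iterX W α g x0 ξ) k +
      (1 + 4 * α * L + 2 * α ^ 2 * L ^ 2 + β) * rhoW W ^ 2 *
        consensusError P (iterY W α g x0 ξ) k + Msigma n α L σ := by
  have hn' : (0 : ℝ) < n := by positivity
  have hX : ∀ k i, MemLp (fun ω => iterX W α g x0 ξ k ω i) 2 P := memLp_iterX hg hf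
  have hY : ∀ k i, MemLp (fun ω => iterY W α g x0 ξ k ω i) 2 P := memLp_iterY hg hf
  have hN : ∀ k i, MemLp (fun ω => gradNoise W α f g x0 ξ k ω i) 2 P := fun k i =>
    (memLp_gradNoise hg hf k i).1
  have hH : ∀ k i, MemLp (fun ω => gradient (f i) (iterX W α g x0 ξ k ω i)) 2 P := fun k i =>
    MemLp.gradient_comp (hf i) (hX k i)
  have hHm : ∀ k l, k ≤ l → ∀ i, Measurable[sampleSigma ξ {q | q.1 < l}] fun ω =>
      gradient (f i) (iterX W α g x0 ξ k ω i) := fun k l hkl i =>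
    (hf i).continuous_gradient.measurable.comp (measurable_iterX_past hg hf hkl i)
  have hYm : ∀ i, Measurable[sampleSigma ξ {q | q.1 < k + 1}] fun ω => iterY W α g x0 ξ k ω i :=
    measurable_iterY_past hg hf k
  -- the iterate without the current noise
  let xt : Ω → Fin n → EuclideanSpace ℝ (Fin p) := fun ω i => ∑ j, W i j •
    (iterX W α g x0 ξ k ω j - α • (iterY W α g x0 ξ k ω j - gradNoise W α f g x0 ξ k ω j))
  have hxt : ∀ i, MemLp (fun ω => xt ω i) 2 P := MemLp.mix (z := fun ω j =>
    iterX W α g x0 ξ k ω j - α • (iterY W α g x0 ξ k ω j - gradNoise W α f g x0 ξ k ω j))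
    (fun j => (hX k j).sub (((hY k j).sub (hN k j)).const_smul α)) W
  have hxtm : ∀ i, Measurable[sampleSigma ξ {q | q.1 < k}] fun ω => xt ω i :=
    measurable_mix (z := fun ω j => iterX W α g x0 ξ k ω j - α • (iterY W α g x0 ξ k ω j -
      gradNoise W α f g x0 ξ k ω j)) (fun j => (measurable_iterX_past hg hf le_rfl j).sub
      ((measurable_iterY_sub_past hg hf k j).const_smul α)) W
  let u : Ω → Fin n → EuclideanSpace ℝ (Fin p) := fun ω i =>
    ∑ j, W i j • iterY W α g x0 ξ k ω j - rowMean (iterY W α g x0 ξ k ω)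
  have hu : ∀ i, MemLp (fun ω => u ω i) 2 P := fun i =>
    (MemLp.mix (hY k) W i).sub (MemLp.rowMean (hY k))
  have hum : ∀ i, Measurable[sampleSigma ξ {q | q.1 < k + 1}] fun ω => u ω i := fun i =>
    (measurable_mix hYm W i).sub (measurable_rowMean hYm)
  let D : Ω → Fin n → EuclideanSpace ℝ (Fin p) := fun ω i =>
    gradient (f i) (iterX W α g x0 ξ (k + 1) ω i) - gradient (f i) (iterX W α g x0 ξ k ω i)
  -- integrability of the terms
  have hi0 := integrable_consensusSq (hY (k + 1))
  have hi1 : Integrable (fun ω => ‖rowMean (iterX W α g x0 ξ k ω) - xs‖ ^ 2) P :=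
    integrable_norm_sq ((MemLp.rowMean (hX k)).sub (memLp_const xs))
  have hi2 := integrable_consensusSq (hX k)
  have hi3 := integrable_consensusSq (hY k)
  have hi4 : ∀ k, Integrable (fun ω => ∑ i, ‖gradNoise W α f g x0 ξ k ω i‖ ^ 2) P := fun k =>
    integrable_finsetSum _ fun i _ => integrable_norm_sq (hN k i)
  have hZ6 : ∀ i, MemLp (fun ω => u ω i + D ω i - gradNoise W α f g x0 ξ k ω i) 2 P := fun i =>
    ((hu i).add ((hH (k + 1) i).sub (hH k i))).sub (hN k i)
  -- The iterate at time `k + 1` is determined before the samples of that time are drawn, so this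
  -- factor is orthogonal to the new noise.
  have hZ6m : ∀ i, Measurable[sampleSigma ξ {q | q.1 < k + 1}] fun ω =>
      u ω i + D ω i - gradNoise W α f g x0 ξ k ω i := fun i =>
    ((hum i).add ((hHm (k + 1) (k + 1) le_rfl i).sub (hHm k (k + 1) k.le_succ i))).sub
      (measurable_gradNoise_past hg hf k i)
  have hi6i : ∀ i, Integrable (fun ω => inner ℝ (u ω i + D ω i - gradNoise W α f g x0 ξ k ω i)
      (gradNoise W α f g x0 ξ (k + 1) ω i)) P := fun i =>
    integrable_inner_of_memLp (hZ6 i) (hN (k + 1) i)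
  have hi6 := integrable_finsetSum Finset.univ fun i _ => hi6i i
  have hi7 := integrable_finsetSum Finset.univ fun i _ =>
    integrable_inner_of_memLp (hu i) (hN k i)
  have hZ8 : ∀ i, MemLp (fun ω => gradient (f i) (xt ω i) -
      gradient (f i) (iterX W α g x0 ξ k ω i)) 2 P := fun i =>
    (MemLp.gradient_comp (hf i) (hxt i)).sub (hH k i)
  have hZ8m : ∀ i, Measurable[sampleSigma ξ {q | q.1 < k}] fun ω => gradient (f i) (xt ω i) -
      gradient (f i) (iterX W α g x0 ξ k ω i) := fun i =>
    ((hf i).continuous_gradient.measurable.comp (hxtm i)).sub (hHm k k le_rfl i)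
  have hi8i : ∀ i, Integrable (fun ω => inner ℝ (gradient (f i) (xt ω i) -
      gradient (f i) (iterX W α g x0 ξ k ω i)) (gradNoise W α f g x0 ξ k ω i)) P := fun i =>
    integrable_inner_of_memLp (hZ8 i) (hN k i)
  have hi8 := integrable_finsetSum Finset.univ fun i _ => hi8i i
  have hZ9 : MemLp (fun ω => rowMean (fun i => gradient (f i) (iterX W α g x0 ξ k ω i))) 2 P :=
    MemLp.rowMean (z := fun ω i => gradient (f i) (iterX W α g x0 ξ k ω i)) (hH k)
  have hi9 := (integrable_inner_of_memLp hZ9 (MemLp.rowMean (hN k))).const_mul (n : ℝ)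
  have hi10 := (integrable_norm_sq (MemLp.rowMean (hN k))).const_mul (n : ℝ)
  -- values of the noise terms
  have h4 : ∀ k, ∫ ω, ∑ i, ‖gradNoise W α f g x0 ξ k ω i‖ ^ 2 ∂P ≤ n * σ ^ 2 :=
    integral_sum_norm_sq_gradNoise_le hg hf
  have h6 : ∫ ω, ∑ i, inner ℝ (u ω i + D ω i - gradNoise W α f g x0 ξ k ω i)
      (gradNoise W α f g x0 ξ (k + 1) ω i) ∂P = 0 := by
    rw [integral_finsetSum _ fun i _ => hi6i i]
    exact Finset.sum_eq_zero fun i _ =>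
      integral_inner_gradNoise_eq_zero_of_past hg hf (hZ6m i) (hZ6 i)
  have h7 : -σ ^ 2 ≤ ∫ ω, ∑ i, inner ℝ (u ω i) (gradNoise W α f g x0 ξ k ω i) ∂P :=
    neg_sq_le_integral_inner_mix_gradNoise hn hnn hg hf k
  have h8 : ∫ ω, ∑ i, inner ℝ (gradient (f i) (xt ω i) -
      gradient (f i) (iterX W α g x0 ξ k ω i)) (gradNoise W α f g x0 ξ k ω i) ∂P = 0 := by
    rw [integral_finsetSum _ fun i _ => hi8i i]
    exact Finset.sum_eq_zero fun i _ =>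
      integral_inner_gradNoise_eq_zero_of_past hg hf (hZ8m i) (hZ8 i)
  have h9 : ∫ ω, n * inner ℝ (rowMean (fun i => gradient (f i) (iterX W α g x0 ξ k ω i)))
      (rowMean (gradNoise W α f g x0 ξ k ω)) ∂P = 0 := by
    rw [integral_const_mul, integral_inner_rowMean_gradNoise_of_past hg hf
      (measurable_rowMean (z := fun ω i => gradient (f i) (iterX W α g x0 ξ k ω i))
        (hHm k k le_rfl)) hZ9, mul_zero]
  have h10 := integral_norm_sq_rowMean_gradNoise_le (W := W) (α := α) (x0 := x0) hn hg hf k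
  have hstep : ∀ ω, consensusSq (iterY W α g x0 ξ (k + 1) ω) ≤ _ := fun ω => by
    have h := tracking_step (α := α) (N' := gradNoise W α f g x0 ξ (k + 1) ω) (D := D ω)
      (u := u ω) hn hnn hr hc (fun i => (hf i).lipschitz) hL hα hαL hβ hxs
      (rowMean_iterY (W := W) (α := α) (f := f) (g := g) (x0 := x0) (ξ := ξ) hc k ω)
      (fun i => iterX_succ k ω i) (fun _ => rfl) (fun _ => rfl)
    simp only [← oracle_eq] at h
    exact h
  have h11 := integral_mono hi0 ((((hi1.const_mul (2 * α * n * L ^ 3)).add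
    (hi2.const_mul ((1 / β + 2) * distI W ^ 2 * L ^ 2 + 3 * α * L ^ 3))).add
    (hi3.const_mul ((1 + 4 * α * L + 2 * α ^ 2 * L ^ 2 + β) * rhoW W ^ 2))).add
    (((((((hi4 k).const_mul (1 + 2 * α * L)).add (hi4 (k + 1))).add (hi6.const_mul 2)).sub
      (hi7.const_mul 2)).sub (hi8.const_mul 2)).add
      (((hi9.const_mul 2).add hi10).const_mul (α * L)))) hstep
  rw [integral_add' (((hi1.const_mul _).add (hi2.const_mul _)).add (hi3.const_mul _))
    (((((((hi4 k).const_mul _).add (hi4 (k + 1))).add (hi6.const_mul _)).sub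
      (hi7.const_mul _)).sub (hi8.const_mul _)).add (((hi9.const_mul _).add hi10).const_mul _)),
    integral_add' ((hi1.const_mul _).add (hi2.const_mul _)) (hi3.const_mul _),
    integral_add' (hi1.const_mul _) (hi2.const_mul _),
    integral_add' ((((((hi4 k).const_mul _).add (hi4 (k + 1))).add (hi6.const_mul _)).sub
      (hi7.const_mul _)).sub (hi8.const_mul _)) (((hi9.const_mul _).add hi10).const_mul _),
    integral_sub' (((((hi4 k).const_mul _).add (hi4 (k + 1))).add (hi6.const_mul _)).sub
      (hi7.const_mul _)) (hi8.const_mul _),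
    integral_sub' ((((hi4 k).const_mul _).add (hi4 (k + 1))).add (hi6.const_mul _))
      (hi7.const_mul _),
    integral_add' (((hi4 k).const_mul _).add (hi4 (k + 1))) (hi6.const_mul _),
    integral_add' ((hi4 k).const_mul _) (hi4 (k + 1)),
    integral_const_mul, integral_const_mul, integral_const_mul, integral_const_mul,
    integral_const_mul, integral_const_mul, integral_const_mul, integral_const_mul,
    integral_add' (hi9.const_mul _) hi10, integral_const_mul, h6, h8, h9] at h11
  have h12 := mul_le_mul_of_nonneg_left (h4 k) (show 0 ≤ 1 + 2 * α * L by positivity)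
  have h13 := mul_le_mul_of_nonneg_left h10 (show 0 ≤ α * L by positivity)
  -- The noise terms add up to `(2n + 2αLn + 2 + αL)σ²`; `Msigma` exceeds this by `αLσ² + 3α²L²σ²`.
  have h14 : 0 ≤ α ^ 2 * L ^ 2 * σ ^ 2 := by positivity
  have h15 : 0 ≤ α * L * σ ^ 2 := by positivity
  have h16 := h4 (k + 1)
  simp only [optimalityError, consensusError, Msigma]
  linarith

end Recursion

/-! ### Spectral radius and positive eigenvector of the error matrix -/

section Spectral

/-- A number that is an eigenvalue and bounds the modulus of all complex eigenvalues is the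
spectral radius. -/
theorem realMatrixSpectralRadius_eq {A : Matrix (Fin 3) (Fin 3) ℝ} {r : ℝ} (hr : 0 ≤ r)
    (hroot : (Matrix.scalar (Fin 3) (r : ℂ) - A.map Complex.ofReal).det = 0)
    (hle : ∀ z : ℂ, (Matrix.scalar (Fin 3) z - A.map Complex.ofReal).det = 0 → ‖z‖ ≤ r) :
    realMatrixSpectralRadius A = r := by
  have hmem : ∀ z : ℂ, z ∈ spectrum ℂ (A.map Complex.ofReal) ↔
      (Matrix.scalar (Fin 3) z - A.map Complex.ofReal).det = 0 := by
    intro z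
    rw [spectrum.mem_iff, Matrix.isUnit_iff_isUnit_det, isUnit_iff_ne_zero, not_not]
    rfl
  have h : spectralRadius ℂ (A.map Complex.ofReal) = ENNReal.ofReal r := by
    refine le_antisymm (iSup₂_le fun z hz => ?_) ?_
    · rw [← enorm_eq_nnnorm, ← ofReal_norm]
      exact ENNReal.ofReal_le_ofReal (hle z ((hmem z).1 hz))
    · have := le_iSup₂ (f := fun (k : ℂ) (_ : k ∈ spectrum ℂ (A.map Complex.ofReal)) =>
        (‖k‖₊ : ENNReal))
        (r : ℂ) ((hmem r).2 hroot)
      rw [← enorm_eq_nnnorm, ← ofReal_norm, Complex.norm_real, Real.norm_of_nonneg hr] at this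
      exact this
  rw [realMatrixSpectralRadius, h, ENNReal.toReal_ofReal hr]

/-- Besides the diagonal, only the loop between coordinates 2 and 3 and the full 3-cycle enter. -/
theorem det_scalar_sub_cyclic (a b c d e q : ℝ) (z : ℂ) :
    (Matrix.scalar (Fin 3) z - (!![a, b, 0; 0, c, d; e, q, c] :
      Matrix (Fin 3) (Fin 3) ℝ).map Complex.ofReal).det =
      (z - a) * ((z - c) * (z - c) - d * q) - b * d * e := by
  rw [Matrix.det_fin_three]
  simp
  ring

/-- A root of the characteristic polynomial to the right of the diagonal entries is the spectral
radius. -/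
theorem realMatrixSpectralRadius_cyclic {a b c d e q r : ℝ} (ha : 0 ≤ a) (hc : 0 ≤ c)
    (hdq : 0 ≤ d * q) (hbde : 0 < b * d * e) (har : a < r) (hcr : c < r)
    (hroot : (r - a) * ((r - c) * (r - c) - d * q) = b * d * e) :
    realMatrixSpectralRadius !![a, b, 0; 0, c, d; e, q, c] = r := by
  refine realMatrixSpectralRadius_eq (ha.trans har.le) ?_ fun z hz => ?_
  · rw [det_scalar_sub_cyclic, sub_eq_zero]
    exact_mod_cast hroot
  · rw [det_scalar_sub_cyclic, sub_eq_zero] at hz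
    -- For `‖z‖ > r` the triangle inequality makes the modulus of the left side of the
    -- characteristic equation exceed its value `b * d * e` at `r`.
    by_contra! h
    have h1 : ‖z‖ - a ≤ ‖z - a‖ := by
      have := norm_sub_norm_le z (a : ℂ)
      rwa [Complex.norm_real, Real.norm_of_nonneg ha] at this
    have h2 : ‖z‖ - c ≤ ‖z - c‖ := by
      have := norm_sub_norm_le z (c : ℂ)
      rwa [Complex.norm_real, Real.norm_of_nonneg hc] at this
    have hpos : 0 < (r - c) * (r - c) - d * q :=
      (pos_iff_pos_of_mul_pos (by rw [hroot]; exact hbde)).1 (sub_pos.2 har)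
    have h3 : (r - c) * (r - c) ≤ (‖z‖ - c) * (‖z‖ - c) := by gcongr; linarith
    have h4 : (‖z‖ - c) * (‖z‖ - c) ≤ ‖z - c‖ * ‖z - c‖ := by gcongr; linarith
    have h5 : ‖z - c‖ * ‖z - c‖ - d * q ≤ ‖(z - c) * (z - c) - d * q‖ := by
      have := norm_sub_norm_le ((z - c) * (z - c)) ((d * q : ℝ) : ℂ)
      rw [Complex.norm_real, Real.norm_of_nonneg hdq, norm_mul] at this
      exact_mod_cast this
    have h6 : ‖z - a‖ * ‖(z - c) * (z - c) - d * q‖ = b * d * e := by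
      rw [← norm_mul, hz]
      have : ((b : ℂ) * d * e) = ((b * d * e : ℝ) : ℂ) := by push_cast; ring
      rw [this, Complex.norm_real, Real.norm_of_nonneg hbde.le]
    have h7 : (r - a) * ((r - c) * (r - c) - d * q) <
        ‖z - a‖ * ‖(z - c) * (z - c) - d * q‖ := by
      apply mul_lt_mul (by linarith) (by linarith) hpos (norm_nonneg _)
    linarith

/-- The spectral radius in the decoupled case. -/
theorem realMatrixSpectralRadius_triangular {a b c e q : ℝ} (ha : 0 ≤ a) (hc : 0 ≤ c) :
    realMatrixSpectralRadius !![a, b, 0; 0, c, 0; e, q, c] = max a c := by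
  refine realMatrixSpectralRadius_eq (ha.trans (le_max_left _ _)) ?_ fun z hz => ?_
  · rw [det_scalar_sub_cyclic]
    rcases max_choice a c with h | h <;> simp [h]
  · rw [det_scalar_sub_cyclic] at hz
    have : z = a ∨ z = c := by simpa [sub_eq_zero] using hz
    rcases this with rfl | rfl
    · rw [Complex.norm_real, Real.norm_of_nonneg ha]; exact le_max_left _ _
    · rw [Complex.norm_real, Real.norm_of_nonneg hc]; exact le_max_right _ _

/-- If the determinant of `1 - A` is positive, then the spectral radius is less than one and
comes with a positive eigenvector. -/
theorem exists_eigenvector_cyclic {a b c d e q : ℝ} (ha : 0 ≤ a) (hc : 0 ≤ c) (ha1 : a < 1)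
    (hc1 : c < 1) (hb : 0 < b) (hd : 0 < d) (he : 0 < e) (hq : 0 ≤ q)
    (hdet : b * d * e < (1 - a) * ((1 - c) * (1 - c) - d * q)) :
    ∃ r v₁ v₂ v₃ : ℝ, realMatrixSpectralRadius !![a, b, 0; 0, c, d; e, q, c] = r ∧ 0 ≤ r ∧
      r < 1 ∧ 0 < v₁ ∧ 0 < v₂ ∧ 0 < v₃ ∧ a * v₁ + b * v₂ = r * v₁ ∧ c * v₂ + d * v₃ = r * v₂ ∧
      e * v₁ + q * v₂ + c * v₃ = r * v₃ := by
  have hbde : 0 < b * d * e := by positivity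
  have hdq : 0 ≤ d * q := by positivity
  -- The characteristic polynomial plus `b * d * e`. It is at most zero at `max a c` and exceeds `b
  -- * d * e` at 1, so the level is attained in between.
  let φ : ℝ → ℝ := fun t => (t - a) * ((t - c) * (t - c) - d * q)
  have hcont : ContinuousOn φ (Set.Icc (max a c) 1) := by fun_prop
  have hm : φ (max a c) ≤ 0 := by
    rcases max_choice a c with h | h
    · simp [φ, h]
    · have : a ≤ c := by rw [← h]; exact le_max_left _ _
      simp only [φ, h, sub_self, zero_mul, zero_sub]
      nlinarith
  obtain ⟨r, ⟨hr1, hr2⟩, hr⟩ := intermediate_value_Icc (max_lt ha1 hc1).le hcont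
    ⟨hm.trans hbde.le, hdet.le⟩
  have hr' : (r - a) * ((r - c) * (r - c) - d * q) = b * d * e := hr
  have hra : a < r := by
    refine lt_of_le_of_ne ((le_max_left _ _).trans hr1) fun h => ?_
    rw [← h, sub_self, zero_mul] at hr'
    linarith
  have hpos : 0 < (r - c) * (r - c) - d * q :=
    (pos_iff_pos_of_mul_pos (by rw [hr']; exact hbde)).1 (sub_pos.2 hra)
  have hrc : c < r := by
    refine lt_of_le_of_ne ((le_max_right _ _).trans hr1) fun h => ?_
    rw [← h, sub_self, zero_mul] at hpos
    linarith
  have hr_lt : r < 1 := by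
    refine lt_of_le_of_ne hr2 fun h => ?_
    rw [h] at hr'
    linarith
  have h1 : 0 < r - a := by linarith
  have h2 : 0 < r - c := by linarith
  -- The first two rows determine the vector up to scale; the third is the characteristic equation.
  refine ⟨r, b * d, d * (r - a), (r - c) * (r - a),
    realMatrixSpectralRadius_cyclic ha hc hdq hbde hra hrc hr', by linarith, hr_lt,
    by positivity, by positivity, by positivity, by ring, by ring, by linarith⟩

end Spectral

/-! ### Consequences of the step size bound -/

section StepSize

variable {α μ L Γ ρ w : ℝ}

/-- For `ρ = 1` the second bound would be zero, against `α > 0`. -/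
theorem StepSizeBound.rho_lt_one (h : StepSizeBound α μ L Γ ρ w) (hα : 0 < α) (hρ : ρ ≤ 1) :
    ρ < 1 := by
  refine lt_of_le_of_ne hρ fun h1 => ?_
  have := h.2.1
  simp [h1] at this
  linarith

theorem StepSizeBound.mul_max_le (h : StepSizeBound α μ L Γ ρ w) (hL : 0 < L) (hΓ : 1 < Γ)
    (hρ : 0 ≤ ρ) (hρ1 : ρ < 1) :
    2 * Real.sqrt Γ * (α * L) * max (6 * ρ * w) (1 - ρ ^ 2) ≤ (1 - ρ ^ 2) ^ 2 := by
  have h1 : 0 < 1 - ρ ^ 2 := by nlinarith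
  have h2 : 0 < max (6 * ρ * w) (1 - ρ ^ 2) := lt_max_of_lt_right h1
  have h3 : 0 < Real.sqrt Γ := Real.sqrt_pos.2 (by linarith)
  have := h.2.1
  rw [le_div_iff₀ (by positivity)] at this
  linarith

/-- Uses the entry `1 - ρ²` of the maximum. -/
theorem StepSizeBound.four_mul_sq_le (h : StepSizeBound α μ L Γ ρ w) (hα : 0 < α) (hL : 0 < L)
    (hΓ : 1 < Γ) (hρ : 0 ≤ ρ) (hρ1 : ρ < 1) : 4 * Γ * (α * L) ^ 2 ≤ (1 - ρ ^ 2) ^ 2 := by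
  have h1 : 0 < 1 - ρ ^ 2 := by nlinarith
  have h2 := h.mul_max_le hL hΓ hρ hρ1
  have h3 : 2 * Real.sqrt Γ * (α * L) * (1 - ρ ^ 2) ≤ (1 - ρ ^ 2) * (1 - ρ ^ 2) := by
    calc _ ≤ 2 * Real.sqrt Γ * (α * L) * max (6 * ρ * w) (1 - ρ ^ 2) := by
          gcongr; exact le_max_right _ _
      _ ≤ _ := by linarith
  have h4 := pow_le_pow_left₀ (by positivity) (le_of_mul_le_mul_right h3 h1) 2
  rw [mul_pow, mul_pow, Real.sq_sqrt (by linarith)] at h4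
  linarith

/-- Uses the entry `6ρw` of the maximum. -/
theorem StepSizeBound.mul_sq_le (h : StepSizeBound α μ L Γ ρ w) (hα : 0 < α) (hL : 0 < L)
    (hΓ : 1 < Γ) (hρ : 0 ≤ ρ) (hρ1 : ρ < 1) (hw : 0 ≤ w) :
    144 * Γ * (α * L) ^ 2 * (ρ ^ 2 * w ^ 2) ≤ (1 - ρ ^ 2) ^ 4 := by
  have h2 := h.mul_max_le hL hΓ hρ hρ1
  have h3 : 2 * Real.sqrt Γ * (α * L) * (6 * ρ * w) ≤ (1 - ρ ^ 2) ^ 2 := by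
    refine le_trans ?_ h2
    gcongr; exact le_max_left _ _
  have h4 := pow_le_pow_left₀ (by positivity) h3 2
  rw [mul_pow, mul_pow, mul_pow, Real.sq_sqrt (by linarith)] at h4
  linarith

theorem StepSizeBound.mul_le_half (h : StepSizeBound α μ L Γ ρ w) (hα : 0 < α) (hL : 0 < L)
    (hΓ : 1 < Γ) (hρ : 0 ≤ ρ) (hρ1 : ρ < 1) : α * L ≤ (1 - ρ ^ 2) / 2 := by
  have h1 : 0 < 1 - ρ ^ 2 := by nlinarith
  have h2 := h.four_mul_sq_le hα hL hΓ hρ hρ1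
  have h3 : 0 ≤ (Γ - 1) * (α * L) ^ 2 := mul_nonneg (by linarith) (sq_nonneg _)
  apply le_of_sq_le_sq _ (by positivity)
  rw [div_pow]
  linarith

theorem StepSizeBound.mul_sq_rho_le (h : StepSizeBound α μ L Γ ρ w) (hL : 0 < L) (hρ : 0 < ρ) :
    12 * ρ ^ 2 * (α * L) ≤ 1 - ρ ^ 2 := by
  have h1 := h.1 hρ.ne'
  rw [le_div_iff₀ (by positivity)] at h1
  linarith

theorem StepSizeBound.mul_cube_le (h : StepSizeBound α μ L Γ ρ w) (hα : 0 < α) (hL : 0 < L)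
    (hΓ : 1 < Γ) (hρ : 0 < ρ) : 27 * ρ ^ 2 * (α * L) ^ 3 ≤
      (1 - ρ ^ 2) ^ 3 * (μ ^ 2 / L ^ 2 * ((Γ - 1) / (Γ * (Γ + 1)))) := by
  have h1 := h.2.2 hρ.ne'
  have hΓ1 : 0 < Γ - 1 := by linarith
  set K := μ ^ 2 / L ^ 2 * ((Γ - 1) / (Γ * (Γ + 1)))
  have hK : 0 ≤ K := by positivity
  have hρ' : 0 < ρ ^ (2 / 3 : ℝ) := Real.rpow_pos_of_pos hρ _
  rw [div_mul_eq_mul_div, le_div_iff₀ (by positivity)] at h1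
  have h2 := pow_le_pow_left₀ (by positivity) h1 3
  have e1 : (K ^ (1 / 3 : ℝ)) ^ 3 = K := by
    rw [← Real.rpow_natCast, ← Real.rpow_mul hK]; norm_num
  have e2 : (ρ ^ (2 / 3 : ℝ)) ^ 3 = ρ ^ 2 := by
    rw [← Real.rpow_natCast, ← Real.rpow_mul hρ.le]; norm_num
  rw [mul_pow _ _ 3, mul_pow _ _ 3, mul_pow _ _ 3, mul_pow _ _ 3, e1, e2] at h2
  linarith

/-- The lower bound on `betaConst` in terms of the connectivity. -/
theorem StepSizeBound.le_betaConst (h : StepSizeBound α μ L Γ ρ w) (hα : 0 < α) (hL : 0 < L)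
    (hΓ : 1 < Γ) (hρ : 0 < ρ) (hρ1 : ρ < 1) :
    (1 - ρ ^ 2) * (1 + ρ ^ 2) / (12 * ρ ^ 2) ≤ betaConst α L ρ := by
  have h1 := h.mul_le_half hα hL hΓ hρ.le hρ1
  have h2 := h.mul_sq_rho_le hL hρ
  have hs : 0 < ρ ^ 2 := by positivity
  have hs1 : ρ ^ 2 < 1 := by nlinarith
  have hx : 0 < α * L := by positivity
  have h3 : α * L * (α * L) ≤ α * L * ((1 - ρ ^ 2) / 2) := by gcongr
  -- In the unit `(1 - ρ²)/(12ρ²)` the leading term of `betaConst` is 6 and at most `5 - ρ²` is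
  -- subtracted, leaving `1 + ρ²`.
  have h4 : (5 - ρ ^ 2) * (α * L) ≤ (5 - ρ ^ 2) * ((1 - ρ ^ 2) / (12 * ρ ^ 2)) := by
    have : 0 ≤ 5 - ρ ^ 2 := by linarith
    gcongr
    rw [le_div_iff₀ (by positivity)]; linarith
  have h5 : (1 - ρ ^ 2) / (2 * ρ ^ 2) = 6 * ((1 - ρ ^ 2) / (12 * ρ ^ 2)) := by field_simp; ring
  have h6 : (1 - ρ ^ 2) * (1 + ρ ^ 2) / (12 * ρ ^ 2) =
    (1 + ρ ^ 2) * ((1 - ρ ^ 2) / (12 * ρ ^ 2)) := by ring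
  unfold betaConst
  rw [h5, h6]
  linarith

theorem StepSizeBound.betaConst_pos (h : StepSizeBound α μ L Γ ρ w) (hα : 0 < α) (hL : 0 < L)
    (hΓ : 1 < Γ) (hρ : 0 < ρ) (hρ1 : ρ < 1) : 0 < betaConst α L ρ := by
  refine lt_of_lt_of_le ?_ (h.le_betaConst hα hL hΓ hρ hρ1)
  have : 0 < 1 - ρ ^ 2 := by nlinarith
  positivity

/-- The feedback between consensus error and tracking error is small. -/
theorem StepSizeBound.consensus_tracking_le (h : StepSizeBound α μ L Γ ρ w) (hα : 0 < α)
    (hL : 0 < L) (hΓ : 1 < Γ) (hρ : 0 < ρ) (hρ1 : ρ < 1) (hw : 0 ≤ w) :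
    α ^ 2 * ((1 + ρ ^ 2) * ρ ^ 2 / (1 - ρ ^ 2)) *
      ((1 / betaConst α L ρ + 2) * w ^ 2 * L ^ 2 + 3 * α * L ^ 3) ≤
      1 / Γ * ((1 - ρ ^ 2) / 2) ^ 2 := by
  have hβ := h.le_betaConst hα hL hΓ hρ hρ1
  have h1 := h.four_mul_sq_le hα hL hΓ hρ.le hρ1
  have h2 := h.mul_sq_le hα hL hΓ hρ.le hρ1 hw
  have h3 := h.mul_sq_rho_le hL hρ
  have hd : 0 < 1 - ρ ^ 2 := by nlinarith
  have hb : 1 / betaConst α L ρ ≤ 12 * ρ ^ 2 / ((1 - ρ ^ 2) * (1 + ρ ^ 2)) := by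
    have := one_div_le_one_div_of_le (by positivity) hβ
    rwa [one_div_div] at this
  set s := ρ ^ 2 with hs
  have hs0 : 0 < s := by positivity
  have hs1 : s < 1 := by linarith
  have hΓ0 : 0 < Γ := by linarith
  have hk : 1 / betaConst α L ρ + 2 ≤ (12 * s + 2 * (1 - s ^ 2)) / ((1 - s) * (1 + s)) := by
    refine (add_le_add_left hb 2).trans_eq ?_
    field_simp
    ring
  have hA : 144 * Γ * (α ^ 2 * ((1 + s) * s / (1 - s)) *
      ((1 / betaConst α L ρ + 2) * w ^ 2 * L ^ 2)) ≤ (12 * s + 2 * (1 - s ^ 2)) * (1 - s) ^ 2 := by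
    calc _ = (144 * Γ * (α * L) ^ 2 * (s * w ^ 2)) * ((1 + s) / (1 - s)) *
          (1 / betaConst α L ρ + 2) := by ring
      _ ≤ (144 * Γ * (α * L) ^ 2 * (s * w ^ 2)) * ((1 + s) / (1 - s)) *
          ((12 * s + 2 * (1 - s ^ 2)) / ((1 - s) * (1 + s))) := by gcongr
      _ ≤ (1 - s) ^ 4 * ((1 + s) / (1 - s)) *
          ((12 * s + 2 * (1 - s ^ 2)) / ((1 - s) * (1 + s))) := by
          have : 0 ≤ 1 - s ^ 2 := by nlinarith
          gcongr
      _ = _ := by field_simp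
  have hB : 144 * Γ * (α ^ 2 * ((1 + s) * s / (1 - s)) * (3 * α * L ^ 3)) ≤
      9 * (1 + s) * (1 - s) ^ 2 := by
    calc _ = (4 * Γ * (α * L) ^ 2) * (12 * s * (α * L)) * (9 * ((1 + s) / (1 - s))) := by ring
      _ ≤ (1 - s) ^ 2 * (1 - s) * (9 * ((1 + s) / (1 - s))) := by gcongr
      _ = _ := by field_simp
  -- The target, multiplied by `144Γ`, is `36(1 - s)²`, where `36 = 144/4`.
  have hC : (12 * s + 2 * (1 - s ^ 2)) + 9 * (1 + s) ≤ 36 := by nlinarith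
  have hD := mul_le_mul_of_nonneg_right hC (sq_nonneg (1 - s))
  rw [mul_add (α ^ 2 * ((1 + s) * s / (1 - s))), one_div_mul_eq_div, le_div_iff₀ hΓ0]
  linarith

/-- The feedback around the whole cycle of error quantities is small. -/
theorem StepSizeBound.cycle_le (h : StepSizeBound α μ L Γ ρ w) (hα : 0 < α)
    (hL : 0 < L) (hμ : 0 < μ) (hμL : μ ≤ L) (hΓ : 1 < Γ) (hρ : 0 < ρ) (hρ1 : ρ < 1) {n : ℕ}
    (hn : 0 < n) :
    α * L ^ 2 / (μ * n) * (1 + α * μ) * (α ^ 2 * ((1 + ρ ^ 2) * ρ ^ 2 / (1 - ρ ^ 2))) *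
      (2 * α * n * L ^ 3) ≤
      (Γ - 1) / (Γ * (Γ + 1)) * (α * μ * ((1 - ρ ^ 2) / 2) ^ 2) := by
  have h1 := h.mul_le_half hα hL hΓ hρ.le hρ1
  have h3 := h.mul_cube_le hα hL hΓ hρ
  have hd : 0 < 1 - ρ ^ 2 := by nlinarith
  have hn' : (0 : ℝ) < n := by positivity
  have hμ2 : α * μ ≤ α * L := by gcongr
  have hΓ1 : 0 < Γ - 1 := by linarith
  -- The 27 is the cube of the 3 in the third step size bound; the left side is at most 16.
  have h4 : 8 * ((1 + α * μ) * (1 + ρ ^ 2)) ≤ 27 := by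
    have : (1 + α * μ) * (1 + ρ ^ 2) ≤ (1 + (1 - ρ ^ 2) / 2) * (1 + ρ ^ 2) := by
      gcongr; linarith
    nlinarith
  set κ := (Γ - 1) / (Γ * (Γ + 1)) with hκ
  have hκ0 : 0 < κ := by positivity
  have h5 : 8 * ((1 + α * μ) * (1 + ρ ^ 2)) * (ρ ^ 2 * (α * L) ^ 3) ≤
      (1 - ρ ^ 2) ^ 3 * (μ ^ 2 / L ^ 2 * κ) := by
    refine le_trans ?_ h3
    calc _ ≤ 27 * (ρ ^ 2 * (α * L) ^ 3) := by gcongr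
      _ = _ := by ring
  calc _ = (8 * ((1 + α * μ) * (1 + ρ ^ 2)) * (ρ ^ 2 * (α * L) ^ 3)) *
        (α * L ^ 2 / (4 * μ * (1 - ρ ^ 2))) := by field_simp; ring
    _ ≤ ((1 - ρ ^ 2) ^ 3 * (μ ^ 2 / L ^ 2 * κ)) * (α * L ^ 2 / (4 * μ * (1 - ρ ^ 2))) := by
        gcongr
    _ = _ := by field_simp; ring

end StepSize

/-! ### Linear recursions, their fixed points and limits -/

section Comparison

/-- A nonnegative linear recursion stays below a fixed point plus a decaying eigenvector. -/
theorem exists_le_of_linear_recursion {a b c d e q b₁ b₃ r v₁ v₂ v₃ E₁ E₂ E₃ : ℝ} (ha : 0 ≤ a)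
    (hb : 0 ≤ b) (hc : 0 ≤ c) (hd : 0 ≤ d) (he : 0 ≤ e) (hq : 0 ≤ q) (hr : 0 ≤ r) (hv₁ : 0 < v₁)
    (hv₂ : 0 < v₂) (hv₃ : 0 < v₃) (h₁ : a * v₁ + b * v₂ = r * v₁) (h₂ : c * v₂ + d * v₃ = r * v₂)
    (h₃ : e * v₁ + q * v₂ + c * v₃ = r * v₃) (hE₁ : a * E₁ + b * E₂ + b₁ = E₁)
    (hE₂ : c * E₂ + d * E₃ = E₂) (hE₃ : e * E₁ + q * E₂ + c * E₃ + b₃ = E₃) {x y z : ℕ → ℝ}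
    (hx : ∀ k, x (k + 1) ≤ a * x k + b * y k + b₁) (hy : ∀ k, y (k + 1) ≤ c * y k + d * z k)
    (hz : ∀ k, z (k + 1) ≤ e * x k + q * y k + c * z k + b₃) :
    ∃ C, 0 ≤ C ∧ ∀ k, x k ≤ E₁ + C * r ^ k ∧ y k ≤ E₂ + C * r ^ k := by
  -- Chosen so that the bound holds at time 0; nonnegative coefficients and the eigenvector
  -- equations propagate it.
  let C := |x 0 - E₁| / v₁ + |y 0 - E₂| / v₂ + |z 0 - E₃| / v₃
  have hC : 0 ≤ C := by positivity
  have key : ∀ k, x k ≤ E₁ + C * r ^ k * v₁ ∧ y k ≤ E₂ + C * r ^ k * v₂ ∧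
      z k ≤ E₃ + C * r ^ k * v₃ := by
    intro k
    induction k with
    | zero =>
      have aux : ∀ {t E v : ℝ}, 0 < v → |t - E| / v ≤ C → t ≤ E + C * r ^ 0 * v := by
        intro t E v hv h
        rw [div_le_iff₀ hv] at h
        have := le_abs_self (t - E)
        rw [pow_zero, mul_one]; linarith
      have p1 : 0 ≤ |x 0 - E₁| / v₁ := by positivity
      have p2 : 0 ≤ |y 0 - E₂| / v₂ := by positivity
      have p3 : 0 ≤ |z 0 - E₃| / v₃ := by positivity
      exact ⟨aux hv₁ (by simp only [C]; linarith), aux hv₂ (by simp only [C]; linarith),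
        aux hv₃ (by simp only [C]; linarith)⟩
    | succ k ih =>
      obtain ⟨i1, i2, i3⟩ := ih
      have a1 := mul_le_mul_of_nonneg_left i1 ha
      have b2 := mul_le_mul_of_nonneg_left i2 hb
      have c2 := mul_le_mul_of_nonneg_left i2 hc
      have d3 := mul_le_mul_of_nonneg_left i3 hd
      have e1 := mul_le_mul_of_nonneg_left i1 he
      have q2 := mul_le_mul_of_nonneg_left i2 hq
      have c3 := mul_le_mul_of_nonneg_left i3 hc
      have k1 := congrArg (C * r ^ k * ·) h₁
      have k2 := congrArg (C * r ^ k * ·) h₂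
      have k3 := congrArg (C * r ^ k * ·) h₃
      rw [pow_succ]
      exact ⟨by linarith [hx k], by linarith [hy k], by linarith [hz k]⟩
  refine ⟨C * (v₁ + v₂), by positivity, fun k => ?_⟩
  have hp : 0 ≤ C * r ^ k := by positivity
  obtain ⟨i1, i2, -⟩ := key k
  constructor
  · have := mul_nonneg hp hv₂.le
    linarith
  · have := mul_nonneg hp hv₁.le
    linarith

/-- The fixed point of the recursion, with bounds in terms of the feedback gains. -/
theorem exists_fixedPoint_le {a b d δ e q b₁ b₃ Γ : ℝ} (ha : 0 < a) (hb : 0 < b) (hd : 0 < d)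
    (hδ : 0 < δ) (he : 0 < e) (hb₁ : 0 ≤ b₁) (hb₃ : 0 ≤ b₃) (hΓ : 1 < Γ)
    (h1 : δ * q ≤ 1 / Γ * d ^ 2) (h2 : b * δ * e ≤ (Γ - 1) / (Γ * (Γ + 1)) * (a * d ^ 2)) :
    b * δ * e < a * (d * d - δ * q) ∧ ∃ E₁ E₂ E₃ : ℝ,
      (1 - a) * E₁ + b * E₂ + b₁ = E₁ ∧ (1 - d) * E₂ + δ * E₃ = E₂ ∧
      e * E₁ + q * E₂ + (1 - d) * E₃ + b₃ = E₃ ∧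
      E₁ ≤ (Γ + 1) / Γ * (b₁ / a) + (Γ + 1) / (Γ - 1) * (b * δ * b₃ / (a * d ^ 2)) ∧
      E₂ ≤ (Γ + 1) / (Γ - 1) * (δ * (e * b₁ + a * b₃) / (a * d ^ 2)) := by
  have hΓ1 : 0 < Γ - 1 := by linarith
  have hΓ0 : 0 < Γ := by linarith
  set s := d * d - δ * q with hs
  have hs1 : (Γ - 1) / Γ * d ^ 2 ≤ s := by
    have : (Γ - 1) / Γ * d ^ 2 = d ^ 2 - 1 / Γ * d ^ 2 := by field_simp
    rw [this, hs]; linarith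
  have hs0 : 0 < s := lt_of_lt_of_le (by positivity) hs1
  set Δ := a * s - b * δ * e with hΔ
  -- With `a` and `d` the gaps `1 - A i i`, `Δ` is `det (1 - A)`. The loop gains leave the fraction
  -- `(Γ - 1)/Γ - (Γ - 1)/(Γ(Γ + 1)) = (Γ - 1)/(Γ + 1)` of `a * d²`.
  have hΔ1 : (Γ - 1) / (Γ + 1) * (a * d ^ 2) ≤ Δ := by
    have h3 := mul_le_mul_of_nonneg_left hs1 ha.le
    have : (Γ - 1) / (Γ + 1) * (a * d ^ 2) = a * ((Γ - 1) / Γ * d ^ 2) -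
      (Γ - 1) / (Γ * (Γ + 1)) * (a * d ^ 2) := by field_simp; ring
    rw [this, hΔ]; linarith
  -- A second bound, relative to `a * s`, for the term `b₁ * s / Δ`: it yields the better factor `(Γ
  -- + 1)/Γ`.
  have hΔ2 : Γ / (Γ + 1) * (a * s) ≤ Δ := by
    have h3 := mul_le_mul_of_nonneg_left hs1 (show 0 ≤ a / (Γ + 1) by positivity)
    have e1 : (Γ - 1) / (Γ * (Γ + 1)) * (a * d ^ 2) = a / (Γ + 1) * ((Γ - 1) / Γ * d ^ 2) := by
      field_simp
    have e2 : Γ / (Γ + 1) * (a * s) = a * s - a / (Γ + 1) * s := by field_simp; ring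
    rw [e2, hΔ]; linarith
  have hΔ0 : 0 < Δ := lt_of_lt_of_le (by positivity) hΔ1
  have hΔinv : 1 / Δ ≤ (Γ + 1) / (Γ - 1) * (1 / (a * d ^ 2)) := by
    have := one_div_le_one_div_of_le (by positivity) hΔ1
    refine this.trans_eq ?_
    field_simp
  -- The fixed point by Cramer's rule.
  refine ⟨by linarith, (b₁ * s + b * δ * b₃) / Δ, δ * (e * b₁ + a * b₃) / Δ,
    d * (e * b₁ + a * b₃) / Δ, ?_, ?_, ?_, ?_, ?_⟩
  · field_simp
    rw [hΔ]; ring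
  · field_simp
    ring
  · field_simp
    rw [hΔ, hs]; ring
  · have h3 : b₁ * s / Δ ≤ (Γ + 1) / Γ * (b₁ / a) := by
      rw [div_le_iff₀ hΔ0]
      calc b₁ * s = (Γ + 1) / Γ * (b₁ / a) * (Γ / (Γ + 1) * (a * s)) := by field_simp
        _ ≤ _ := by gcongr
    have h4 : b * δ * b₃ / Δ ≤ (Γ + 1) / (Γ - 1) * (b * δ * b₃ / (a * d ^ 2)) := by
      have := mul_le_mul_of_nonneg_left hΔinv (show 0 ≤ b * δ * b₃ by positivity)
      calc _ = b * δ * b₃ * (1 / Δ) := by ring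
        _ ≤ _ := this
        _ = _ := by ring
    rw [add_div]
    linarith
  · have := mul_le_mul_of_nonneg_left hΔinv (show 0 ≤ δ * (e * b₁ + a * b₃) by positivity)
    calc _ = δ * (e * b₁ + a * b₃) * (1 / Δ) := by ring
      _ ≤ _ := this
      _ = _ := by ring

/-- Consequences of geometric convergence to a neighbourhood of zero. -/
theorem bounds_of_le_add_mul_pow {u : ℕ → ℝ} {R C r : ℝ} (hu0 : ∀ k, 0 ≤ u k) (hC : 0 ≤ C)
    (hr0 : 0 ≤ r) (hr1 : r < 1) (hu : ∀ k, u k ≤ R + C * r ^ k) :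
    BddAbove (Set.range u) ∧ (∀ k j, ⨆ l : Set.Ici k, u ((l : ℕ) + j) ≤ R + C * r ^ k) ∧
      limsup u atTop ≤ R := by
  refine ⟨⟨R + C, ?_⟩, fun k j => ?_, ?_⟩
  · rintro _ ⟨k, rfl⟩
    have := mul_le_mul_of_nonneg_left (pow_le_one₀ hr0 hr1.le (n := k)) hC
    linarith [hu k]
  · have : Nonempty (Set.Ici k) := ⟨⟨k, Set.mem_Ici.2 le_rfl⟩⟩
    refine ciSup_le fun l => (hu _).trans ?_
    have h1 : r ^ ((l : ℕ) + j) ≤ r ^ k :=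
      pow_le_pow_of_le_one hr0 hr1.le (le_add_right l.2)
    gcongr
  · have ht : Tendsto (fun k => R + C * r ^ k) atTop (nhds R) := by
      simpa using ((tendsto_pow_atTop_nhds_zero_of_lt_one hr0 hr1).const_mul C).const_add R
    rw [← ht.limsup_eq]
    refine limsup_le_limsup (Eventually.of_forall hu) ?_ ht.isBoundedUnder_le
    -- Nonnegativity keeps the real `limsup` from taking a default value.
    exact isCoboundedUnder_le_of_le atTop hu0

/-- The decoupled recursion: the second error vanishes after one step. -/
theorem exists_le_of_scalar_recursion {a b b₁ E : ℝ} (ha : 0 < a) (hE : a * E + b₁ = E)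
    {x y : ℕ → ℝ} (hx : ∀ k, x (k + 1) ≤ a * x k + b * y k + b₁) (hy : ∀ k, y (k + 1) = 0)
    {r : ℝ} (har : a ≤ r) : ∃ C, 0 ≤ C ∧ ∀ k, x k ≤ E + C * r ^ k ∧ y k ≤ C * r ^ k := by
  -- The recursion for `x` decouples only from index 1 on, since `y 0` may be nonzero; hence index 1
  -- is treated as an initial value too, at the cost of dividing by `a`.
  let C := |x 0 - E| + |x 1 - E| / a + |y 0|
  have p1 : 0 ≤ |x 0 - E| := abs_nonneg _
  have p2 : 0 ≤ |x 1 - E| / a := by positivity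
  have p3 : 0 ≤ |y 0| := abs_nonneg _
  have hC : 0 ≤ C := by positivity
  have key : ∀ k, x (k + 1) ≤ E + C * a ^ (k + 1) := by
    intro k
    induction k with
    | zero =>
      have h : |x 1 - E| / a ≤ C := by simp only [C]; linarith
      rw [div_le_iff₀ ha] at h
      rw [zero_add, pow_one]
      linarith [le_abs_self (x 1 - E)]
    | succ k ih =>
      have h1 := hx (k + 1)
      rw [hy k] at h1
      have h2 := mul_le_mul_of_nonneg_left ih ha.le
      rw [pow_succ a (k + 1)]
      linarith
  refine ⟨C, hC, fun k => ?_⟩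
  have hpow : C * a ^ k ≤ C * r ^ k := by gcongr
  cases k with
  | zero =>
    rw [pow_zero, mul_one]
    constructor
    · have := le_abs_self (x 0 - E)
      simp only [C]; linarith
    · have := le_abs_self (y 0)
      simp only [C]; linarith
  | succ k =>
    refine ⟨(key k).trans (by linarith), ?_⟩
    rw [hy k]
    have := ha.trans_le har
    positivity

end Comparison

/-! ### Assembly -/

theorem optimalityError_nonneg {Ω : Type*} [MeasurableSpace Ω] {P : Measure Ω} {n p : ℕ}
    (X : ℕ → Ω → Fin n → EuclideanSpace ℝ (Fin p)) (xs : EuclideanSpace ℝ (Fin p)) (k : ℕ) :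
    0 ≤ optimalityError P X xs k :=
  integral_nonneg fun _ => sq_nonneg _

theorem consensusError_nonneg {Ω : Type*} [MeasurableSpace Ω] {P : Measure Ω} {n p : ℕ}
    (X : ℕ → Ω → Fin n → EuclideanSpace ℝ (Fin p)) (k : ℕ) : 0 ≤ consensusError P X k :=
  integral_nonneg fun _ => Finset.sum_nonneg fun _ _ => sq_nonneg _

/-- Geometric convergence of the two errors to a neighbourhood of zero. -/
theorem exists_errors_le {Ω : Type*} [MeasurableSpace Ω] {P : Measure Ω} [IsProbabilityMeasure P]
    {n p m : ℕ} {W : Matrix (Fin n) (Fin n) ℝ} (hn : 0 < n) (hnn : ∀ i j, 0 ≤ W i j)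
    (hr : ∀ i, ∑ j, W i j = 1) (hc : ∀ j, ∑ i, W i j = 1)
    {f : Fin n → EuclideanSpace ℝ (Fin p) → ℝ} {μ L : ℝ} (hμ : 0 < μ) (hμL : μ ≤ L)
    (hf : ∀ i, IsStronglyConvexSmooth (f i) μ L)
    {g : Fin n → EuclideanSpace ℝ (Fin p) → EuclideanSpace ℝ (Fin m) → EuclideanSpace ℝ (Fin p)}
    {ξ : ℕ → Fin n → Ω → EuclideanSpace ℝ (Fin m)} {σ : ℝ}
    (hg : IsGradientOracle P f g ξ σ) {xs : EuclideanSpace ℝ (Fin p)}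
    (hxs : rowMean (fun i => gradient (f i) xs) = 0) {x0 : Fin n → EuclideanSpace ℝ (Fin p)}
    {α Γ : ℝ} (hΓ : 1 < Γ) (hα : 0 < α) (hαle : StepSizeBound α μ L Γ (rhoW W) (distI W)) :
    ∃ r, realMatrixSpectralRadius (matA n α μ L (rhoW W) (distI W)) = r ∧ 0 ≤ r ∧ r < 1 ∧
      ∃ C, 0 ≤ C ∧ ∀ k,
        optimalityError P (iterX W α g x0 ξ) xs k ≤
          optimalityBound n α μ L σ Γ (rhoW W) + C * r ^ k ∧
        consensusError P (iterX W α g x0 ξ) k ≤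
          consensusBound n α μ L σ Γ (rhoW W) + C * r ^ k := by
  have hn' : (0 : ℝ) < n := by positivity
  have hL : 0 < L := hμ.trans_le hμL
  have hρ0 : 0 ≤ rhoW W := rhoW_nonneg
  have hw : 0 ≤ distI W := distI_nonneg
  have hρ1 : rhoW W < 1 := hαle.rho_lt_one hα (rhoW_le_one hn hnn hr hc)
  have hd : 0 < 1 - rhoW W ^ 2 := by nlinarith
  have hhalf := hαle.mul_le_half hα hL hΓ hρ0 hρ1
  have hαL : α * L ≤ 1 / 2 := by nlinarith [sq_nonneg (rhoW W)]
  have hαμ : α * μ ≤ 1 / 2 := le_trans (by gcongr) hαL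
  have hΓ1 : 0 < Γ - 1 := by linarith
  have hopt := optimalityError_succ_le (x0 := x0) hn hc hg hf hμ hL hα hαL hαμ hxs
  -- For `ρ = 0`, `betaConst` divides by zero; the matrix is then decoupled and the entry with `β`
  -- is irrelevant.
  rcases hρ0.eq_or_lt with hρ | hρ
  · have hρ' : rhoW W = 0 := hρ.symm
    have hA : matA n α μ L (rhoW W) (distI W) = !![1 - α * μ,
        α * L ^ 2 / (μ * n) * (1 + α * μ), 0; 0, 1 / 2, 0; 2 * α * n * L ^ 3,
        (1 / betaConst α L 0 + 2) * distI W ^ 2 * L ^ 2 + 3 * α * L ^ 3, 1 / 2] := by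
      simp [matA, hρ']
    obtain ⟨C, hC, h⟩ := exists_le_of_scalar_recursion (a := 1 - α * μ) (E := α * σ ^ 2 / (μ * n))
      (by linarith) (by field_simp; ring) hopt
      (consensusError_succ_eq_zero hn hr hc hρ') (r := max (1 - α * μ) (1 / 2)) (le_max_left _ _)
    refine ⟨max (1 - α * μ) (1 / 2), ?_, ?_, ?_, C, hC, fun k => ?_⟩
    · rw [hA, realMatrixSpectralRadius_triangular (by linarith) (by norm_num)]
    · exact le_max_of_le_right (by norm_num)
    · have : 0 < α * μ := by positivity
      exact max_lt (by linarith) (by norm_num)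
    · have h1 : α * σ ^ 2 / (μ * n) ≤ optimalityBound n α μ L σ Γ (rhoW W) := by
        simp only [optimalityBound, hρ']
        have : (1 : ℝ) ≤ (Γ + 1) / Γ := by rw [le_div_iff₀ (by linarith)]; linarith
        have := mul_le_mul_of_nonneg_right this (show 0 ≤ α * σ ^ 2 / (μ * n) by positivity)
        simpa using this
      have h2 : consensusBound n α μ L σ Γ (rhoW W) = 0 := by simp [consensusBound, hρ']
      obtain ⟨h3, h4⟩ := h k
      exact ⟨by linarith, by linarith⟩
  · have hβ := hαle.betaConst_pos hα hL hΓ hρ hρ1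
    have hP1 := hαle.consensus_tracking_le hα hL hΓ hρ hρ1 hw
    have hP2 := hαle.cycle_le hα hL hμ hμL hΓ hρ hρ1 hn
    have hM : 0 ≤ Msigma n α L σ := by unfold Msigma; positivity
    -- The arguments are the gaps `1 - A i i`, not the diagonal entries.
    obtain ⟨hdet, E₁, E₂, E₃, hE₁, hE₂, hE₃, hle₁, hle₂⟩ := exists_fixedPoint_le
      (b₁ := α ^ 2 * σ ^ 2 / n) (b₃ := Msigma n α L σ)
      (show 0 < α * μ by positivity)
      (show 0 < α * L ^ 2 / (μ * n) * (1 + α * μ) by positivity)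
      (show 0 < (1 - rhoW W ^ 2) / 2 by positivity)
      (show 0 < α ^ 2 * ((1 + rhoW W ^ 2) * rhoW W ^ 2 / (1 - rhoW W ^ 2)) by positivity)
      (show 0 < 2 * α * n * L ^ 3 by positivity) (by positivity) hM hΓ hP1 hP2
    have hhalf' : 1 - (1 - rhoW W ^ 2) / 2 = (1 + rhoW W ^ 2) / 2 := by ring
    rw [hhalf'] at hE₂ hE₃
    obtain ⟨r, v₁, v₂, v₃, hrA, hr0, hr1, hv₁, hv₂, hv₃, h₁, h₂, h₃⟩ := exists_eigenvector_cyclic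
      (a := 1 - α * μ) (b := α * L ^ 2 / (μ * n) * (1 + α * μ)) (c := (1 + rhoW W ^ 2) / 2)
      (d := α ^ 2 * ((1 + rhoW W ^ 2) * rhoW W ^ 2 / (1 - rhoW W ^ 2)))
      (e := 2 * α * n * L ^ 3)
      (q := (1 / betaConst α L (rhoW W) + 2) * distI W ^ 2 * L ^ 2 + 3 * α * L ^ 3)
      (by linarith) (by positivity) (sub_lt_self _ (by positivity)) (by linarith) (by positivity)
      (by positivity) (by positivity) (by positivity)
      (by rw [← hhalf', sub_sub_cancel, sub_sub_cancel]; exact hdet)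
    have htrack := trackingError_succ_le (x0 := x0) hn hnn hr hc hg hf hL hα hαL hβ hxs
    -- `betaConst` is the Young parameter for which the tracking error gets the same diagonal
    -- coefficient as the consensus error.
    have hcoef : (1 + 4 * α * L + 2 * α ^ 2 * L ^ 2 + betaConst α L (rhoW W)) * rhoW W ^ 2 =
        (1 + rhoW W ^ 2) / 2 := by
      unfold betaConst; field_simp; ring
    rw [hcoef] at htrack
    obtain ⟨C, hC, h⟩ := exists_le_of_linear_recursion (by linarith) (by positivity)
      (by positivity) (by positivity) (by positivity) (by positivity) hr0 hv₁ hv₂ hv₃ h₁ h₂ h₃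
      hE₁ hE₂ hE₃ hopt (consensusError_succ_le hn hr hc hρ.ne' hρ1 hg hf) htrack
    have hR₁ : E₁ ≤ optimalityBound n α μ L σ Γ (rhoW W) := by
      refine hle₁.trans_eq ?_
      unfold optimalityBound
      field_simp
      ring
    have hR₂ : E₂ ≤ consensusBound n α μ L σ Γ (rhoW W) := by
      refine hle₂.trans_eq ?_
      unfold consensusBound
      field_simp
      ring
    refine ⟨r, hrA, hr0, hr1, C, hC, fun k => ?_⟩
    obtain ⟨h4, h5⟩ := h k
    exact ⟨by linarith, by linarith⟩

theorem theorem1 {Ω : Type*} [MeasurableSpace Ω] (P : Measure Ω) [IsProbabilityMeasure P]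
    {n p m : ℕ} (hp : 1 ≤ p)
    (G : SimpleGraph (Fin n)) (W : Matrix (Fin n) (Fin n) ℝ) (hW : IsNetwork G W)
    (f : Fin n → EuclideanSpace ℝ (Fin p) → ℝ) (μ L : ℝ) (hμ : 0 < μ)
    (hf : ∀ i, IsStronglyConvexSmooth (f i) μ L)
    (g : Fin n → EuclideanSpace ℝ (Fin p) → EuclideanSpace ℝ (Fin m) → EuclideanSpace ℝ (Fin p))
    (ξ : ℕ → Fin n → Ω → EuclideanSpace ℝ (Fin m)) (σ : ℝ) (hσ : 0 < σ)
    (hg : IsGradientOracle P f g ξ σ)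
    (xs : EuclideanSpace ℝ (Fin p))
    (hxs : ∀ x, (1 / (n : ℝ)) * ∑ i, f i xs ≤ (1 / (n : ℝ)) * ∑ i, f i x)
    (x0 : Fin n → EuclideanSpace ℝ (Fin p))
    (X : ℕ → Ω → Fin n → EuclideanSpace ℝ (Fin p)) (α : ℝ)
    (hX : ∀ k ω, X k ω = (dsgt W α g x0 (fun j i => ξ j i ω) k).1)
    (Γ : ℝ) (hΓ : 1 < Γ) (hα : 0 < α)
    (hαle : StepSizeBound α μ L Γ (rhoW W) (distI W))
    (ρA : ℝ) (hρA : ρA = realMatrixSpectralRadius (matA n α μ L (rhoW W) (distI W))) :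
    -- the expectations and suprema below are finite
    ((∀ k, Integrable (fun ω => ‖rowMean (X k ω) - xs‖ ^ 2) P) ∧
      (∀ k, Integrable (fun ω => consensusSq (X k ω)) P) ∧
      BddAbove (Set.range (optimalityError P X xs)) ∧
      BddAbove (Set.range (consensusError P X))) ∧
    -- linear convergence at rate `O(ρ_A ^ k)`, to a neighbourhood of zero
    ρA < 1 ∧
    (∃ C : ℝ, ∀ k : ℕ, ⨆ l : Set.Ici k, optimalityError P X xs l ≤
      optimalityBound n α μ L σ Γ (rhoW W) + C * ρA ^ k) ∧
    (∃ C : ℝ, ∀ k : ℕ, ⨆ l : Set.Ici k, consensusError P X (l + 1) ≤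
      consensusBound n α μ L σ Γ (rhoW W) + C * ρA ^ k) ∧
    -- limiting error bounds
    limsup (optimalityError P X xs) atTop ≤ optimalityBound n α μ L σ Γ (rhoW W) ∧
    limsup (consensusError P X) atTop ≤ consensusBound n α μ L σ Γ (rhoW W) := by
  -- A positive diagonal entry exhibits an agent, hence `n > 0`.
  obtain ⟨i₀, -⟩ := hW.exists_diag_pos
  have hn : 0 < n := i₀.pos
  have hL := mu_le_lipschitz hp (hf i₀)
  obtain rfl : X = iterX W α g x0 ξ := funext fun k => funext fun ω => hX k ω
  obtain ⟨r, hr, hr0, hr1, C, hC, h⟩ := exists_errors_le (x0 := x0) hn hW.nonneg hW.row_sum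
    hW.col_sum hμ hL hf hg (rowMean_gradient_eq_zero (fun i => (hf i).differentiable) hxs)
    hΓ hα hαle
  rw [hr] at hρA
  subst hρA
  obtain ⟨hb₁, hs₁, hl₁⟩ := bounds_of_le_add_mul_pow (optimalityError_nonneg _ xs) hC hr0 hr1
    fun k => (h k).1
  obtain ⟨hb₂, hs₂, hl₂⟩ := bounds_of_le_add_mul_pow (consensusError_nonneg _) hC hr0 hr1
    fun k => (h k).2
  have hX2 : ∀ k i, MemLp (fun ω => iterX W α g x0 ξ k ω i) 2 P := memLp_iterX hg hf
  exact ⟨⟨fun k => integrable_norm_sq ((MemLp.rowMean (hX2 k)).sub (memLp_const xs)),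
    fun k => integrable_consensusSq (hX2 k), hb₁, hb₂⟩, hr1, ⟨C, fun k => hs₁ k 0⟩,
    ⟨C, fun k => hs₂ k 1⟩, hl₁, hl₂⟩
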